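/- For $a\in(0,1)$ write $\bar a=1-a$. Let $\varphi,\gamma\in(0,1)$ with $\varphi+\gamma\ge 1$, let $\alpha=\min(\varphi,\gamma)$, and let $\psi=\varphi/\gamma$ if $\varphi\le\gamma$ and $\psi=\bar\varphi/\bar\gamma$ if $\varphi>\gamma$. For each $N$ let $(X_t^{(N)})_{t\ge 0}$ be the Markov chain on $\{0,1\}^N$ driven by random vectors $(Z_t^{(N)})_{t\ge 1}$ in $\{0,1\}^N$ as follows: $Z_t^{(N)}$ has exchangeable coordinates and a law that does not depend on $t$, $Z^{(N)}_t$ is independent of $(X^{(N)}_0,\dots,X^{(N)}_{t-1})$, and, given $(X_0^{(N)},\dots,X_{t-1}^{(N)})$ with $X_{t-1}^{(N)}=x$ and given $Z_t^{(N)}=z$, the coordinates of $X_t^{(N)}$ are independent with $$\mathbb P(X_t^{(N)}[k]=y\mid x,z)=\varphi^{y}\bar\varphi^{\,1-y}\Big\{1+\frac{\alpha}{\bar\alpha}\Big(1-\frac{z[k]}{\alpha}\Big)\Big(1-\frac{y}{\varphi}\Big)\Big(1-\frac{x[k]}{\gamma}\Big)\Big\},\qquad y\in\{0,1\}.$$ Let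 $\|x\|$ be the number of ones of $x$. Fix $t\ge1$ and suppose that $\|Z_t^{(N)}\|/N\to\Theta_t$ in distribution as $N\to\infty$, where $\Theta_t$ is a random variable in $[0,1]$. Put $$V_t^{(N)}=N^{-1/2}(\|X_t^{(N)}\|-N\varphi),\qquad U_t^{(N)}=N^{-1/2}(\|X_{t-1}^{(N)}\|-N\gamma),$$ $$\mu_\infty(\theta,u)=\psi\Big(1-\frac{\theta}{\alpha}\Big)u,\qquad \sigma_\infty^2(\theta)=\varphi\bar\varphi\Big(1-\frac{\bar\varphi}{\varphi}\,\frac{\bar\gamma}{\gamma}\Big(\frac{\alpha}{\bar\alpha}\Big)^2\Big(1-\frac{\theta}{\alpha}\Big)^2\Big).$$ Then $\sigma_\infty^2(\theta)\ge 0$ for $\theta\in[0,1]$, and, with the convention that a normal law of variance $0$ is a point mass, the following hold. (a) If $N\to\infty$ along a sequence of dimensions, $\theta_N\to\theta$ and $u_N\to u$ are real sequences, and $\mathbb P(\|Z_t^{(N)}\|/N=\theta_N,\ U_t^{(N)}=u_N)>0$ along the sequence, then the conditional law of $V_t^{(N)}$ given $\|Z_t^{(N)}\|/N=\theta_N$ and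 $U_t^{(N)}=u_N$ converges weakly to the normal law with mean $\mu_\infty(\theta,u)$ and variance $\sigma_\infty^2(\theta)$. (b) If $U_t^{(N)}$ converges in distribution to a random variable $U_t$, then $(\|Z_t^{(N)}\|/N,\,U_t^{(N)},\,V_t^{(N)})$ converges jointly in distribution to a triple $(\Theta_t,U_t,V_t)$ in which $\Theta_t$ and $U_t$ are independent and the conditional law of $V_t$ given $\Theta_t=\theta$, $U_t=u$ is normal with mean $\mu_\infty(\theta,u)$ and variance $\sigma_\infty^2(\theta)$. -/

import Mathlib

open MeasureTheory ProbabilityTheory Filter Topology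

noncomputable section

namespace HypercubeWalk

/-- Vertices of the `N`-dimensional hypercube `{0,1}^N`; `true` stands for `1`. -/
abbrev Cube (N : ℕ) : Type := Fin N → Bool

/-- The number `0` or `1` that a coordinate stands for. -/
def bit (b : Bool) : ℝ := if b then 1 else 0

/-- `‖x‖`: the Hamming distance of `x` from the zero vertex. -/
def hamming {N : ℕ} (x : Cube N) : ℕ := (Finset.univ.filter fun k => x k = true).card

/-- `α = min {φ, γ}`. -/
def alpha (φ γ : ℝ) : ℝ := min φ γ

/-- `ψ = φ / γ` if `φ ≤ γ`, and `ψ = (1 - φ) / (1 - γ)` if `φ > γ`. -/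
def psi (φ γ : ℝ) : ℝ := if φ ≤ γ then φ / γ else (1 - φ) / (1 - γ)

/-- Transition probability of a single coordinate from `x` to `y`, given that the coordinate of the
driving vector is `z`:
`φ^y (1-φ)^(1-y) {1 + α/(1-α) (1 - z/α) (1 - y/φ) (1 - x/γ)}`. -/
def coordTransition (φ γ : ℝ) (z x y : Bool) : ℝ :=
  (if y then φ else 1 - φ) *
    (1 + alpha φ γ / (1 - alpha φ γ) * (1 - bit z / alpha φ γ) * (1 - bit y / φ) * (1 - bit x / γ))

/-- `(X_t)_{t ≥ 0}` is the long-range random walk on the hypercube `{0,1}^N` with parameters `φ, γ`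
driven by `(Z_t)_{t ≥ 1}`, where the `Z_t` have exchangeable coordinates and are homogeneous in
time.  In the step from `t` to `t + 1`, the vector `Z_{t+1}` is independent of `(X_0, …, X_t)`, and,
given `(X_0, …, X_t)` and `Z_{t+1}`, the coordinates change independently, each by
`coordTransition`.  (The value `Z 0` plays no role.) -/
structure IsExchangeableWalk (φ γ : ℝ) {N : ℕ} {Ω : Type*} [MeasurableSpace Ω] (P : Measure Ω)
    (X Z : ℕ → Ω → Cube N) : Prop where
  measurable_X : ∀ t, Measurable (X t)
  measurable_Z : ∀ t, Measurable (Z t)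
  exchangeable : ∀ (t : ℕ) (σ : Equiv.Perm (Fin N)) (z : Cube N),
    P {ω | Z (t + 1) ω = fun k => z (σ k)} = P {ω | Z (t + 1) ω = z}
  homogeneous : ∀ (t : ℕ) (z : Cube N), P {ω | Z (t + 1) ω = z} = P {ω | Z 1 ω = z}
  transition : ∀ (t : ℕ) (x : ℕ → Cube N) (z : Cube N),
    P.real {ω | (∀ s ≤ t, X s ω = x s) ∧ Z (t + 1) ω = z ∧ X (t + 1) ω = x (t + 1)} =
      P.real {ω | ∀ s ≤ t, X s ω = x s} * P.real {ω | Z (t + 1) ω = z} *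
        ∏ k, coordTransition φ γ (z k) (x t k) (x (t + 1) k)

/-- `‖z‖ / N`, the proportion of ones. -/
def density {N : ℕ} (z : Cube N) : ℝ := (hamming z : ℝ) / N

/-- `N^{-1/2} (‖x‖ - N p)`. -/
def scaled (p : ℝ) {N : ℕ} (x : Cube N) : ℝ := (Real.sqrt N)⁻¹ * ((hamming x : ℝ) - N * p)

/-- `ψ (1 - θ/α) u`. -/
def limitMean (φ γ θ u : ℝ) : ℝ := psi φ γ * (1 - θ / alpha φ γ) * u

/-- `φ(1-φ) (1 - ((1-φ)/φ) ((1-γ)/γ) (α/(1-α))² (1 - θ/α)²)`. -/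
def limitVariance (φ γ θ : ℝ) : ℝ :=
  φ * (1 - φ) * (1 - (1 - φ) / φ * ((1 - γ) / γ) * (alpha φ γ / (1 - alpha φ γ)) ^ 2 *
    (1 - θ / alpha φ γ) ^ 2)

/-- The normal law with mean `limitMean` and variance `limitVariance`, as a function of `(θ, u)`.
A normal law of variance `0` is a point mass. -/
def limitKernel (φ γ : ℝ) : Kernel (ℝ × ℝ) ℝ where
  toFun p := gaussianReal (limitMean φ γ p.1 p.2) (limitVariance φ γ p.1).toNNReal
  measurable' := by
    have h : Measurable fun p : ℝ × ℝ =>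
        (limitMean φ γ p.1 p.2, (limitVariance φ γ p.1).toNNReal) := by
      unfold limitMean limitVariance
      fun_prop
    exact measurable_gaussianReal.comp h

instance (φ γ : ℝ) : IsMarkovKernel (limitKernel φ γ) :=
  ⟨fun p => by
    change IsProbabilityMeasure
      (gaussianReal (limitMean φ γ p.1 p.2) (limitVariance φ γ p.1).toNNReal)
    infer_instance⟩

end HypercubeWalk

end

noncomputable section

namespace HypercubeWalk

/-! Fix the current state `x` and condition `Z` on its density; the law of `Z` stays exchangeable
and its number of ones is now fixed. With `h = s/√N`, the characteristic function of the next scaled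
state is a unimodular factor times the average over `z` of `∏ (a + b c(z k) B k)`. Here `a` is the
characteristic function of a Bernoulli(φ) variable, `b = O(N^{-1/2})`, `c` is `driveFactor`, and `B
k = 1 - x k/γ`. If every `c(z k)` is replaced by its limiting mean `τ`, the product splits into
powers of two Bernoulli-type factors, one for the coordinates where `x` is 0 and one for those where
it is 1. A second-order expansion gives the normal limit (`tendsto_two_bernoulli_charFun`). The
replacement is `tendsto_sum_prod_sub`. By exchangeability, the average is `∑ a^(N-r) b^r e_r(B)
D_r`, with `e_r` elementary symmetric and `D_r` the mixed moment of `r` coordinates. The fixed sum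
forces `D_r → τ^r` (`tendsto_mixedMoment`). Because `∑ B k = O(√N)`, Cauchy's estimate gives `e_r(B)
= O(N^{r/2})` with an arbitrarily small geometric factor (`abs_elemSymm_le`), so dominated
convergence applies to the series in `r`. The limit depends on the states only through the limits of
density and scaled distance, so averaging over all `x` with the prescribed distance preserves it;
this gives (a). For (b), `Z` and the current state are independent, so their limits pair into a
product law. The convergence in (a) holds along arbitrary convergent conditioning values, hence
uniformly on compact sets. Together with tightness this yields joint convergence
(`tendstoInDistribution_compProd`). -/

/-! ### Limits of powers of Bernoulli characteristic functions. -/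

lemma tendsto_one_add_pow_exp {ι : Type*} {l : Filter ι} {k : ι → ℕ} {z : ι → ℂ} {L : ℂ}
    (hz : Tendsto z l (𝓝 0)) (hkz : Tendsto (fun i => (k i : ℂ) * z i) l (𝓝 L)) :
    Tendsto (fun i => (1 + z i) ^ k i) l (𝓝 (Complex.exp L)) := by
  have hsmall : ∀ᶠ i in l, ‖z i‖ < 1 / 2 := by
    have := hz.norm
    rw [norm_zero] at this
    exact this.eventually_lt_const (by norm_num)
  have hlog : Tendsto (fun i => (k i : ℂ) * Complex.log (1 + z i)) l (𝓝 L) := by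
    have hdiff : Tendsto (fun i => (k i : ℂ) * Complex.log (1 + z i) - (k i : ℂ) * z i) l
        (𝓝 0) := by
      have hb : Tendsto (fun i => ‖(k i : ℂ) * z i‖ * ‖z i‖) l (𝓝 0) := by
        simpa using hkz.norm.mul hz.norm
      refine squeeze_zero_norm' ?_ hb
      filter_upwards [hsmall] with i hi
      rw [← mul_sub, norm_mul, norm_mul, mul_assoc]
      refine mul_le_mul_of_nonneg_left ?_ (norm_nonneg _)
      refine (Complex.norm_log_one_add_sub_self_le (by linarith)).trans ?_
      have h2 : (1 - ‖z i‖)⁻¹ ≤ 2 := by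
        rw [inv_le_comm₀ (by linarith) (by norm_num)]
        linarith
      nlinarith [sq_nonneg ‖z i‖]
    simpa using hdiff.add hkz
  refine (hlog.cexp).congr' ?_
  filter_upwards [hsmall] with i hi
  have hne : 1 + z i ≠ 0 := by
    intro h0
    have : z i = -1 := by linear_combination h0
    rw [this] at hi
    norm_num at hi
  rw [Complex.exp_nat_mul, Complex.exp_log hne]

lemma norm_exp_sub_quadratic_le {x : ℂ} (hx : ‖x‖ ≤ 1) :
    ‖Complex.exp x - (1 + x + x ^ 2 / 2)‖ ≤ ‖x‖ ^ 3 := by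
  have h := Complex.exp_bound hx (n := 3) (by norm_num)
  simp only [Finset.sum_range_succ, Finset.sum_range_zero] at h
  norm_num [Nat.factorial] at h
  refine h.trans ?_
  nlinarith [pow_nonneg (norm_nonneg x) 3]

/-- Second order expansion of the characteristic function of a centred Bernoulli variable. -/
lemma isBigO_bernoulli_charFun (p : ℝ) :
    (fun h : ℝ => (1 + p * (Complex.exp (Complex.I * h) - 1)) * Complex.exp (-(Complex.I * p * h))
      - 1 + p * (1 - p) * (h : ℂ) ^ 2 / 2) =O[𝓝 0] fun h : ℝ => h ^ 3 := by
  have key : ∀ c : ℝ, (fun h : ℝ => Complex.exp (Complex.I * c * h) -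
      (1 + Complex.I * c * h + (Complex.I * c * h) ^ 2 / 2)) =O[𝓝 0] fun h : ℝ => h ^ 3 := by
    intro c
    refine Asymptotics.IsBigO.of_bound (|c| ^ 3) ?_
    have : Tendsto (fun h : ℝ => ‖Complex.I * c * h‖) (𝓝 0) (𝓝 0) := by
      have : Continuous fun h : ℝ => ‖Complex.I * c * h‖ := by fun_prop
      simpa using this.tendsto 0
    filter_upwards [this.eventually_le_const (show (0 : ℝ) < 1 by norm_num)] with h hh
    refine (norm_exp_sub_quadratic_le hh).trans (le_of_eq ?_)
    simp [mul_pow]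
  -- The centred variable takes the values `-p` and `1 - p` with weights `1 - p` and `p`; the linear
  -- terms cancel and the quadratic ones add up to `p(1-p)`.
  have h1 := ((key (-p)).const_mul_left (1 - p : ℂ)).add ((key (1 - p)).const_mul_left (p : ℂ))
  refine h1.congr_left fun h => ?_
  have e1 : Complex.exp (Complex.I * ((1 - p : ℝ) : ℂ) * h) =
      Complex.exp (Complex.I * h) * Complex.exp (-(Complex.I * p * h)) := by
    rw [← Complex.exp_add]; congr 1; push_cast; ring
  have e2 : Complex.exp (Complex.I * ((-p : ℝ) : ℂ) * h) =
      Complex.exp (-(Complex.I * p * h)) := by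
    congr 1; push_cast; ring
  rw [e1, e2]
  push_cast
  linear_combination (-(1 - p) * p ^ 2 / 2 - p * (1 - p) ^ 2 / 2 : ℂ) * (h : ℂ) ^ 2 * Complex.I_sq

/-- Each factor is `1 - p(1-p)h²/2 + O(h³)` with `k h² → κ s²` and `k h³ → 0`. This is an expansion
only, so `p` may be any real number and the parameters used later need not be checked to be
probabilities. -/
lemma tendsto_bernoulli_charFun_pow {ι : Type*} {l : Filter ι} (p κ s : ℝ) {N k : ι → ℕ}
    (hN : Tendsto N l atTop) (hk : Tendsto (fun i => (k i : ℝ) / N i) l (𝓝 κ)) :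
    Tendsto (fun i => ((1 + p * (Complex.exp (Complex.I * (s / √(N i) : ℝ)) - 1)) *
        Complex.exp (-(Complex.I * p * (s / √(N i) : ℝ)))) ^ k i) l
      (𝓝 (Complex.exp (-((κ * p * (1 - p) * s ^ 2 / 2 : ℝ) : ℂ)))) := by
  set h : ι → ℝ := fun i => s / √(N i) with hh
  have hNr : Tendsto (fun i => √(N i : ℝ)) l atTop :=
    Real.tendsto_sqrt_atTop.comp (tendsto_natCast_atTop_atTop.comp hN)
  have h0 : Tendsto h l (𝓝 0) := hNr.const_div_atTop s
  have hsq : ∀ᶠ i in l, (k i : ℝ) * h i ^ 2 = (k i : ℝ) / N i * s ^ 2 := by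
    filter_upwards with i
    simp only [hh, div_pow, Real.sq_sqrt (Nat.cast_nonneg _)]
    ring
  have hk2 : Tendsto (fun i => (k i : ℝ) * h i ^ 2) l (𝓝 (κ * s ^ 2)) :=
    (hk.mul_const _).congr' (hsq.mono fun i hi => hi.symm)
  set R : ℝ → ℂ := fun h => (1 + p * (Complex.exp (Complex.I * h) - 1)) *
    Complex.exp (-(Complex.I * p * h)) - 1 + p * (1 - p) * (h : ℂ) ^ 2 / 2 with hR
  have hRO := (isBigO_bernoulli_charFun p).comp_tendsto h0
  have hkR : Tendsto (fun i => (k i : ℂ) * R (h i)) l (𝓝 0) := by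
    have h3 : Tendsto (fun i => (k i : ℝ) * h i ^ 3) l (𝓝 0) := by
      have := hk2.mul h0
      rw [mul_zero] at this
      exact this.congr fun i => by ring
    have hO : (fun i => (k i : ℂ) * R (h i)) =O[l] fun i => (k i : ℝ) * h i ^ 3 := by
      refine Asymptotics.IsBigO.mul ?_ hRO
      exact Asymptotics.IsBigO.of_bound 1 (by simp)
    exact hO.trans_tendsto h3
  have hR0 : Tendsto (fun i => R (h i)) l (𝓝 0) :=
    hRO.trans_tendsto (by simpa [Function.comp_def] using h0.pow 3)
  have hz : Tendsto (fun i => R (h i) - p * (1 - p) * (h i : ℂ) ^ 2 / 2) l (𝓝 0) := by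
    have : Tendsto (fun i => (p * (1 - p) * (h i : ℂ) ^ 2 / 2)) l (𝓝 0) := by
      have h0' : Tendsto (fun i => (h i : ℂ)) l (𝓝 0) := by
        simpa [Function.comp_def] using (Complex.continuous_ofReal.tendsto 0).comp h0
      simpa using ((h0'.pow 2).const_mul ((p : ℂ) * (1 - p))).div_const 2
    simpa using hR0.sub this
  have hkz : Tendsto (fun i => (k i : ℂ) * (R (h i) - p * (1 - p) * (h i : ℂ) ^ 2 / 2)) l
      (𝓝 (-((κ * p * (1 - p) * s ^ 2 / 2 : ℝ) : ℂ))) := by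
    have h2 : Tendsto (fun i => (((k i : ℝ) * h i ^ 2 : ℝ) : ℂ)) l (𝓝 ((κ * s ^ 2 : ℝ) : ℂ)) :=
      (Complex.continuous_ofReal.tendsto _).comp hk2
    have := hkR.sub (h2.mul_const ((p : ℂ) * (1 - p) / 2))
    convert this using 2
    · push_cast; ring
    · push_cast; ring
  refine (tendsto_one_add_pow_exp hz hkz).congr fun i => ?_
  congr 1
  simp only [hR, hh]
  ring

/-- The characteristic function of a normalised sum of `N - m` and `m` independent Bernoulli
variables whose two parameters have mean `φ` under the weights `1 - γ`, `γ`. -/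
lemma tendsto_two_bernoulli_charFun {ι : Type*} {l : Filter ι} (φ γ τ s u : ℝ) (hγ : 0 < γ)
    {N m : ι → ℕ} (hN : Tendsto N l atTop) (hm : ∀ i, m i ≤ N i)
    (hu : Tendsto (fun i => (√(N i))⁻¹ * ((m i : ℝ) - N i * γ)) l (𝓝 u)) :
    Tendsto (fun i => Complex.exp (-(Complex.I * s * φ * √(N i))) *
        ((1 + (φ - (1 - φ) * τ : ℝ) * (Complex.exp (Complex.I * (s / √(N i) : ℝ)) - 1)) ^ (N i - m i) *
         (1 + (φ + (1 - φ) * τ * ((1 - γ) / γ) : ℝ) *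
          (Complex.exp (Complex.I * (s / √(N i) : ℝ)) - 1)) ^ m i)) l
      (𝓝 (Complex.exp (s * ((1 - φ) * τ / γ * u : ℝ) * Complex.I -
        (φ * (1 - φ) - (1 - φ) ^ 2 * τ ^ 2 * ((1 - γ) / γ) : ℝ) * s ^ 2 / 2))) := by
  have hNr : Tendsto (fun i => √(N i : ℝ)) l atTop :=
    Real.tendsto_sqrt_atTop.comp (tendsto_natCast_atTop_atTop.comp hN)
  have hNpos : ∀ᶠ i in l, 0 < √(N i : ℝ) := hNr.eventually_gt_atTop 0
  have hmN : Tendsto (fun i => (m i : ℝ) / N i) l (𝓝 γ) := by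
    have h1 : Tendsto (fun i => (√(N i))⁻¹ * ((√(N i))⁻¹ * ((m i : ℝ) - N i * γ)) + γ) l
        (𝓝 (0 * u + γ)) := (hNr.inv_tendsto_atTop.mul hu).add_const _
    rw [zero_mul, zero_add] at h1
    refine h1.congr' ?_
    filter_upwards [hNpos] with i hi
    have hs : √(N i : ℝ) ^ 2 = N i := Real.sq_sqrt (Nat.cast_nonneg _)
    have : (N i : ℝ) ≠ 0 := by rw [← hs]; positivity
    rw [← mul_assoc, ← mul_inv, ← sq, hs]
    field_simp
    ring
  have hmN' : Tendsto (fun i => ((N i - m i : ℕ) : ℝ) / N i) l (𝓝 (1 - γ)) := by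
    refine (hmN.const_sub 1).congr' ?_
    filter_upwards [hN.eventually_gt_atTop 0] with i hi
    have : (N i : ℝ) ≠ 0 := by positivity
    rw [Nat.cast_sub (hm i)]
    field_simp
  set p0 : ℝ := φ - (1 - φ) * τ with hp0
  set p1 : ℝ := φ + (1 - φ) * τ * ((1 - γ) / γ) with hp1
  have t0 := tendsto_bernoulli_charFun_pow p0 (1 - γ) s hN hmN'
  have t1 := tendsto_bernoulli_charFun_pow p1 γ s hN hmN
  -- What centring leaves over: `(N - m) p0 + m p1 - N φ = ((1-φ)τ/γ)(m - Nγ)`, the source of the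
  -- limiting mean.
  have t2 : Tendsto (fun i => Complex.exp
      (Complex.I * ((s * ((1 - φ) * τ / γ) * ((√(N i))⁻¹ * ((m i : ℝ) - N i * γ)) : ℝ) : ℂ))) l
      (𝓝 (Complex.exp (Complex.I * ((s * ((1 - φ) * τ / γ) * u : ℝ) : ℂ)))) :=
    (((Complex.continuous_ofReal.tendsto _).comp (hu.const_mul _)).const_mul _).cexp
  have t := t2.mul (t0.mul t1)
  have hlim : Complex.exp (s * ((1 - φ) * τ / γ * u : ℝ) * Complex.I -
        (φ * (1 - φ) - (1 - φ) ^ 2 * τ ^ 2 * ((1 - γ) / γ) : ℝ) * s ^ 2 / 2) =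
      Complex.exp (Complex.I * ((s * ((1 - φ) * τ / γ) * u : ℝ) : ℂ)) *
      (Complex.exp (-(((1 - γ) * p0 * (1 - p0) * s ^ 2 / 2 : ℝ) : ℂ)) *
        Complex.exp (-((γ * p1 * (1 - p1) * s ^ 2 / 2 : ℝ) : ℂ))) := by
    rw [← Complex.exp_add, ← Complex.exp_add]
    congr 1
    -- Since `(1-γ) p0 + γ p1 = φ`, the averaged Bernoulli variance is `φ(1-φ)` minus the variance
    -- of the parameter under the weights `1-γ`, `γ`.
    have hv : φ * (1 - φ) - (1 - φ) ^ 2 * τ ^ 2 * ((1 - γ) / γ) =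
        (1 - γ) * p0 * (1 - p0) + γ * p1 * (1 - p1) := by
      simp only [hp0, hp1]; field_simp; ring
    rw [hv]
    push_cast
    ring
  rw [hlim]
  refine t.congr' ?_
  filter_upwards [hNpos] with i hi
  rw [mul_pow, mul_pow, ← Complex.exp_nat_mul, ← Complex.exp_nat_mul]
  have e : Complex.exp (Complex.I * ((s * ((1 - φ) * τ / γ) *
      ((√(N i))⁻¹ * ((m i : ℝ) - N i * γ)) : ℝ) : ℂ)) *
      (Complex.exp (((N i - m i : ℕ) : ℂ) * -(Complex.I * p0 * (s / √(N i) : ℝ))) *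
       Complex.exp ((m i : ℂ) * -(Complex.I * p1 * (s / √(N i) : ℝ)))) =
      Complex.exp (-(Complex.I * s * φ * √(N i))) := by
    rw [← Complex.exp_add, ← Complex.exp_add]
    congr 1
    have hr : s * ((1 - φ) * τ / γ) * ((√(N i))⁻¹ * ((m i : ℝ) - N i * γ)) -
        ((N i : ℝ) - m i) * p0 * (s / √(N i)) - m i * p1 * (s / √(N i)) = - (s * φ * √(N i)) := by
      have hs : (N i : ℝ) = √(N i : ℝ) ^ 2 := (Real.sq_sqrt (Nat.cast_nonneg _)).symm
      simp only [hp0, hp1]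
      generalize √(N i : ℝ) = q at *
      rw [hs]
      field_simp
      ring
    have hc := congrArg (fun r : ℝ => (Complex.I : ℂ) * (r : ℂ)) hr
    rw [Nat.cast_sub (hm i)]
    push_cast at hc ⊢
    linear_combination hc
  rw [← e]
  ring

/-! ### Mixed moments of exchangeable weights. -/

/-- A probability weight on the hypercube that is invariant under permutations of coordinates. -/
structure IsExchangeableWeight {N : ℕ} (w : Cube N → ℝ) : Prop where
  nonneg : ∀ z, 0 ≤ w z
  sum_eq_one : ∑ z, w z = 1
  comp_perm : ∀ (σ : Equiv.Perm (Fin N)) (z : Cube N), w (fun k => z (σ k)) = w z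

/-- The mixed moment `E ∏_{k ∈ S} c (z k)` under the weight `w`. -/
def mixedMoment {N : ℕ} (w : Cube N → ℝ) (c : Bool → ℝ) (S : Finset (Fin N)) : ℝ :=
  ∑ z, w z * ∏ k ∈ S, c (z k)

lemma exists_perm_map_eq {α : Type*} [Fintype α] [DecidableEq α] {S T : Finset α}
    (h : S.card = T.card) : ∃ σ : Equiv.Perm α, S.map σ.toEmbedding = T := by
  obtain ⟨σ, hσ⟩ := (Set.powersetCard.isPretransitive (α := α) (n := T.card)).exists_smul_eq
    ⟨S, h⟩ ⟨T, rfl⟩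
  refine ⟨σ, ?_⟩
  have h1 : (σ • (⟨S, h⟩ : Set.powersetCard α T.card)).val = T := congrArg Subtype.val hσ
  rw [← h1]
  ext x
  simp only [Finset.mem_map_equiv, Set.powersetCard.coe_smul, Finset.mem_smul_finset,
    Equiv.Perm.smul_def]
  exact ⟨fun hx => ⟨_, hx, by simp⟩, by rintro ⟨y, hy, rfl⟩; simpa using hy⟩

namespace IsExchangeableWeight

variable {N : ℕ} {w : Cube N → ℝ}

lemma mixedMoment_map (hw : IsExchangeableWeight w) (c : Bool → ℝ) (S : Finset (Fin N))
    (σ : Equiv.Perm (Fin N)) : mixedMoment w c (S.map σ.toEmbedding) = mixedMoment w c S := by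
  unfold mixedMoment
  refine Fintype.sum_equiv (σ.symm.arrowCongr (Equiv.refl Bool)) _ _ fun z => ?_
  have h1 : (σ.symm.arrowCongr (Equiv.refl Bool)) z = fun k => z (σ k) := by
    ext k; simp [Equiv.arrowCongr]
  rw [h1, hw.comp_perm, Finset.prod_map]
  rfl

/-- Some permutation carries `S` onto `T`. Hence one moment per cardinality suffices, and initial
segments serve as representatives. -/
lemma mixedMoment_eq_of_card_eq (hw : IsExchangeableWeight w) (c : Bool → ℝ)
    {S T : Finset (Fin N)} (h : S.card = T.card) : mixedMoment w c S = mixedMoment w c T := by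
  obtain ⟨σ, rfl⟩ := exists_perm_map_eq h
  exact (hw.mixedMoment_map c S σ).symm

lemma abs_mixedMoment_le (hw : IsExchangeableWeight w) {c : Bool → ℝ} {M : ℝ}
    (hc : ∀ b, |c b| ≤ M) (S : Finset (Fin N)) : |mixedMoment w c S| ≤ M ^ S.card := by
  calc |mixedMoment w c S| ≤ ∑ z, |w z * ∏ k ∈ S, c (z k)| := Finset.abs_sum_le_sum_abs _ _
    _ ≤ ∑ z, w z * M ^ S.card := by
        refine Finset.sum_le_sum fun z _ => ?_
        rw [abs_mul, abs_of_nonneg (hw.nonneg z), Finset.abs_prod]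
        refine mul_le_mul_of_nonneg_left ?_ (hw.nonneg z)
        refine (Finset.prod_le_prod (fun _ _ => abs_nonneg _) fun k _ => hc (z k)).trans ?_
        simp
    _ = M ^ S.card := by rw [← Finset.sum_mul, hw.sum_eq_one, one_mul]

/-- Recursion for the mixed moments when `∑ k, c (z k)` is constant on the support of `w`. -/
lemma abs_mixedMoment_insert_sub_le (hw : IsExchangeableWeight w) {c : Bool → ℝ} {M T : ℝ}
    (hM : 1 ≤ M) (hc : ∀ b, |c b| ≤ M) (hT : ∀ z, w z ≠ 0 → ∑ k, c (z k) = N * T)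
    {S : Finset (Fin N)} {j : Fin N} (hj : j ∉ S) :
    |((N : ℝ) - S.card) * mixedMoment w c (insert j S) - N * T * mixedMoment w c S| ≤
      S.card * M ^ (S.card + 1) := by
  -- Multiply the moment by the constant sum and expand. The indices outside `S` contribute `N -
  -- |S|` copies of the next moment; the `|S|` indices inside are the error.
  have h1 : N * T * mixedMoment w c S =
      ∑ k, ∑ z, w z * (c (z k) * ∏ i ∈ S, c (z i)) := by
    rw [Finset.sum_comm, mixedMoment, Finset.mul_sum]
    refine Finset.sum_congr rfl fun z _ => ?_
    rw [← Finset.mul_sum, ← Finset.sum_mul]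
    by_cases hz : w z = 0
    · simp [hz]
    · rw [hT z hz]; ring
  have h2 : ∑ k ∈ Finset.univ \ S, ∑ z, w z * (c (z k) * ∏ i ∈ S, c (z i)) =
      ((N : ℝ) - S.card) * mixedMoment w c (insert j S) := by
    have : ∀ k ∈ Finset.univ \ S, ∑ z, w z * (c (z k) * ∏ i ∈ S, c (z i)) =
        mixedMoment w c (insert j S) := by
      intro k hk
      have hk' : k ∉ S := (Finset.mem_sdiff.1 hk).2
      rw [hw.mixedMoment_eq_of_card_eq c (T := insert k S) (by
        rw [Finset.card_insert_of_notMem hj, Finset.card_insert_of_notMem hk'])]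
      simp only [mixedMoment, Finset.prod_insert hk']
    rw [Finset.sum_congr rfl this, Finset.sum_const, Finset.card_sdiff_of_subset (Finset.subset_univ _),
      Finset.card_univ, Fintype.card_fin, nsmul_eq_mul, Nat.cast_sub]
    simpa using Finset.card_le_univ S
  rw [h1, ← Finset.sum_sdiff (Finset.subset_univ S), h2, sub_add_cancel_left, abs_neg]
  calc |∑ k ∈ S, ∑ z, w z * (c (z k) * ∏ i ∈ S, c (z i))|
      ≤ ∑ k ∈ S, M ^ (S.card + 1) := by
        refine (Finset.abs_sum_le_sum_abs _ _).trans (Finset.sum_le_sum fun k _ => ?_)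
        calc |∑ z, w z * (c (z k) * ∏ i ∈ S, c (z i))|
            ≤ ∑ z, w z * M ^ (S.card + 1) := by
              refine (Finset.abs_sum_le_sum_abs _ _).trans (Finset.sum_le_sum fun z _ => ?_)
              rw [abs_mul, abs_of_nonneg (hw.nonneg z), abs_mul, Finset.abs_prod, pow_succ']
              refine mul_le_mul_of_nonneg_left ?_ (hw.nonneg z)
              refine mul_le_mul (hc _) ?_ (Finset.prod_nonneg fun _ _ => abs_nonneg _) (by linarith)
              refine (Finset.prod_le_prod (fun _ _ => abs_nonneg _) fun k _ => hc (z k)).trans ?_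
              simp
          _ = M ^ (S.card + 1) := by rw [← Finset.sum_mul, hw.sum_eq_one, one_mul]
    _ = S.card * M ^ (S.card + 1) := by simp

end IsExchangeableWeight

/-- The mixed moments of exchangeable weights with fixed mean factorise asymptotically. -/
lemma tendsto_mixedMoment {ι : Type*} {l : Filter ι} {N : ι → ℕ} (hN : Tendsto N l atTop)
    {w : (i : ι) → Cube (N i) → ℝ} (hw : ∀ i, IsExchangeableWeight (w i)) (c : Bool → ℝ)
    {T : ι → ℝ} {τ : ℝ} (hT : ∀ i z, w i z ≠ 0 → ∑ k, c (z k) = N i * T i)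
    (hτ : Tendsto T l (𝓝 τ)) (r : ℕ) :
    Tendsto (fun i => mixedMoment (w i) c (Finset.univ.filter fun k => (k : ℕ) < r)) l
      (𝓝 (τ ^ r)) := by
  obtain ⟨M, hM1, hM⟩ : ∃ M : ℝ, 1 ≤ M ∧ ∀ b, |c b| ≤ M := by
    refine ⟨1 + |c true| + |c false|, ?_, ?_⟩
    · have := abs_nonneg (c true); have := abs_nonneg (c false); linarith
    · have := abs_nonneg (c true); have := abs_nonneg (c false)
      rintro (_ | _) <;> linarith
  have hNr : Tendsto (fun i => (N i : ℝ)) l atTop := tendsto_natCast_atTop_atTop.comp hN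
  induction r with
  | zero => simpa [mixedMoment, (hw _).sum_eq_one] using tendsto_const_nhds
  | succ r ih =>
    set D : ℕ → ι → ℝ := fun r i =>
      mixedMoment (w i) c (Finset.univ.filter fun k => (k : ℕ) < r) with hD
    have hratio : Tendsto (fun i => (N i : ℝ) / (N i - r)) l (𝓝 1) := by
      have h1 : Tendsto (fun i => 1 - (r : ℝ) / N i) l (𝓝 1) := by
        simpa using (hNr.const_div_atTop (r : ℝ)).const_sub 1
      have h2 := h1.inv₀ one_ne_zero
      rw [inv_one] at h2
      refine h2.congr' ?_
      filter_upwards [hNr.eventually_gt_atTop (r : ℝ)] with i hi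
      have h0 : (N i : ℝ) ≠ 0 := by have := Nat.cast_nonneg (α := ℝ) r; linarith
      have h3 : (N i : ℝ) - r ≠ 0 := by linarith
      rw [← inv_div]
      field_simp
    have hmain : Tendsto (fun i => (N i : ℝ) / (N i - r) * (T i * D r i)) l (𝓝 (τ ^ (r + 1))) := by
      have := hratio.mul (hτ.mul ih)
      rwa [one_mul, ← pow_succ'] at this
    have herr : Tendsto (fun i => D (r + 1) i - (N i : ℝ) / (N i - r) * (T i * D r i)) l (𝓝 0) := by
      have hb : Tendsto (fun i => (r * M ^ (r + 1)) / ((N i : ℝ) - r)) l (𝓝 0) :=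
        Tendsto.const_div_atTop (tendsto_atTop_add_const_right _ (-(r : ℝ)) hNr) _
      refine squeeze_zero_norm' ?_ hb
      filter_upwards [hN.eventually_gt_atTop r] with i hi
      have hpos : (0 : ℝ) < N i - r := by
        have : (r : ℝ) < N i := by exact_mod_cast hi
        linarith
      have hcard : (Finset.univ.filter fun k : Fin (N i) => (k : ℕ) < r).card = r := by
        rw [Fin.card_filter_val_lt]; exact min_eq_right hi.le
      have hins : (Finset.univ.filter fun k : Fin (N i) => (k : ℕ) < r + 1) =
          insert ⟨r, hi⟩ (Finset.univ.filter fun k : Fin (N i) => (k : ℕ) < r) := by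
        ext k; simp [Fin.ext_iff]; omega
      have := (hw i).abs_mixedMoment_insert_sub_le hM1 hM (hT i)
        (S := Finset.univ.filter fun k => (k : ℕ) < r) (j := ⟨r, hi⟩) (by simp)
      rw [hcard, ← hins] at this
      rw [Real.norm_eq_abs, le_div_iff₀ hpos]
      refine le_trans (le_of_eq ?_) this
      rw [← abs_of_pos hpos, ← abs_mul, abs_of_pos hpos]
      simp only [hD]
      field_simp
    have h := herr.add hmain
    rw [zero_add] at h
    exact h.congr fun i => sub_add_cancel _ _

/-! ### Elementary symmetric polynomials and the replacement of the drive by its mean. -/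

/-- Elementary symmetric polynomial of the entries of `B`. -/
def elemSymm {N : ℕ} (B : Fin N → ℝ) (r : ℕ) : ℝ :=
  ∑ S ∈ Finset.powersetCard r Finset.univ, ∏ k ∈ S, B k

lemma elemSymm_eq_zero {N : ℕ} (B : Fin N → ℝ) {r : ℕ} (h : N < r) : elemSymm B r = 0 := by
  rw [elemSymm, Finset.powersetCard_eq_empty.2 (by simpa using h), Finset.sum_empty]

lemma prod_add_mul_eq_sum_elemSymm {N : ℕ} (a b : ℂ) (B : Fin N → ℝ) :
    ∏ k, (a + b * B k) = ∑ r ∈ Finset.range (N + 1), a ^ (N - r) * b ^ r * elemSymm B r := by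
  have h := Finset.prod_add (fun k => b * (B k : ℂ)) (fun _ => a) Finset.univ
  rw [Finset.sum_powerset] at h
  simp only [add_comm a, h, Finset.card_univ, Fintype.card_fin]
  refine Finset.sum_congr rfl fun r _ => ?_
  rw [elemSymm, Complex.ofReal_sum, Finset.mul_sum]
  refine Finset.sum_congr rfl fun S hS => ?_
  have hc := (Finset.mem_powersetCard.1 hS).2
  rw [Finset.prod_mul_distrib, Finset.prod_const, Finset.prod_const,
    Finset.card_sdiff_of_subset (Finset.subset_univ _), hc, Finset.card_univ, Fintype.card_fin,
    Complex.ofReal_prod]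
  ring

/-- In the subset expansion, the moment over `S` depends on `|S|` alone and factors out. This
separates the driving vector (moments) from the starting point (elementary symmetric polynomials of
`B`). -/
lemma IsExchangeableWeight.sum_prod_eq {N : ℕ} {w : Cube N → ℝ} (hw : IsExchangeableWeight w)
    (c : Bool → ℝ) (a b : ℂ) (B : Fin N → ℝ) :
    ∑ z, (w z : ℂ) * ∏ k, (a + b * (c (z k) * B k)) =
      ∑ r ∈ Finset.range (N + 1), a ^ (N - r) * b ^ r * elemSymm B r *
        (mixedMoment w c (Finset.univ.filter fun k => (k : ℕ) < r) : ℂ) := by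
  have h : ∀ z : Cube N, (w z : ℂ) * ∏ k, (a + b * (c (z k) * B k)) =
      ∑ r ∈ Finset.range (N + 1), ∑ S ∈ Finset.powersetCard r Finset.univ,
        a ^ (N - r) * b ^ r * (∏ k ∈ S, (B k : ℂ)) * (w z * ∏ k ∈ S, (c (z k) : ℂ)) := by
    intro z
    have := prod_add_mul_eq_sum_elemSymm a b (fun k => c (z k) * B k)
    push_cast at this
    rw [this, Finset.mul_sum]
    refine Finset.sum_congr rfl fun r _ => ?_
    rw [elemSymm, Complex.ofReal_sum, Finset.mul_sum, Finset.mul_sum]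
    refine Finset.sum_congr rfl fun S _ => ?_
    rw [Complex.ofReal_prod]
    push_cast
    rw [Finset.prod_mul_distrib]
    ring
  simp only [h]
  rw [Finset.sum_comm]
  refine Finset.sum_congr rfl fun r hr => ?_
  rw [Finset.sum_comm, elemSymm, Complex.ofReal_sum, Finset.mul_sum, Finset.sum_mul]
  refine Finset.sum_congr rfl fun S hS => ?_
  have hc := (Finset.mem_powersetCard.1 hS).2
  have hcard : S.card = (Finset.univ.filter fun k : Fin N => (k : ℕ) < r).card := by
    rw [Fin.card_filter_val_lt, hc]
    have := Finset.mem_range.1 hr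
    omega
  rw [← Finset.mul_sum, ← hw.mixedMoment_eq_of_card_eq c hcard, mixedMoment, Complex.ofReal_prod]
  push_cast
  rfl

/-- Cauchy's estimate for the coefficients of a polynomial. -/
lemma norm_coeff_mul_pow_le (n : ℕ) (e : ℕ → ℂ) {R C : ℝ} (hR : 0 < R)
    (h : ∀ z : ℂ, ‖z‖ = R → ‖∑ r ∈ Finset.range n, z ^ r * e r‖ ≤ C) {r : ℕ} (hr : r < n) :
    ‖e r‖ ≤ C / R ^ r := by
  set p : Polynomial ℂ := ∑ r ∈ Finset.range n, Polynomial.monomial r (e r) with hp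
  have heval : ∀ z, p.eval z = ∑ r ∈ Finset.range n, z ^ r * e r := by
    intro z
    simp [hp, Polynomial.eval_finsetSum, mul_comm]
  have hcoeff : p.coeff r = e r := by
    simp [hp, Polynomial.coeff_monomial, hr]
  have h1 := Complex.norm_iteratedDeriv_le_of_forall_mem_sphere_norm_le (c := 0) (f := fun z => p.eval z)
    (C := C) r hR p.differentiable.diffContOnCl (fun z hz => by
      rw [heval]; exact h z (by simpa using hz))
  have h2 : iteratedDeriv r (fun z => p.eval z) 0 = r.factorial * e r := by
    have h3 : ∀ (m : ℕ) (q : Polynomial ℂ), iteratedDeriv m (fun z => q.eval z) =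
        fun z => (Polynomial.derivative^[m] q).eval z := by
      intro m
      induction m with
      | zero => intro q; simp
      | succ m ih =>
        intro q
        have hd : deriv (fun z => q.eval z) = fun z => q.derivative.eval z :=
          funext fun z => q.deriv
        rw [iteratedDeriv_succ', hd, ih, Function.iterate_succ_apply]
    rw [h3]
    simp only [← Polynomial.coeff_zero_eq_eval_zero, Polynomial.coeff_iterate_derivative]
    rw [zero_add, Nat.descFactorial_self, hcoeff, nsmul_eq_mul]
  rw [h2, norm_mul, Complex.norm_natCast, mul_div_assoc] at h1
  exact le_of_mul_le_mul_left h1 (by positivity)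

/-- From `|1+w|² = 1 + 2 Re w + |w|² ≤ exp(2 Re w + |w|²)`. The linear terms are added before
absolute values are taken, so cancellation in `∑ B k` is kept; `∑ |B k|` would be too large. -/
lemma norm_prod_one_add_mul_le {N : ℕ} (c : ℂ) (B : Fin N → ℝ) {M : ℝ} (hM : ∀ k, |B k| ≤ M) :
    ‖∏ k, (1 + c * B k)‖ ≤ Real.exp (‖c‖ * |∑ k, B k| + ‖c‖ ^ 2 * (N * M ^ 2) / 2) := by
  have h1 : ∀ k, ‖1 + c * (B k : ℂ)‖ ≤ Real.exp (c.re * B k + ‖c‖ ^ 2 * B k ^ 2 / 2) := by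
    intro k
    refine le_of_sq_le_sq ?_ (Real.exp_nonneg _)
    rw [← Real.exp_nat_mul, Complex.sq_norm, Complex.sq_norm, Complex.normSq_apply,
      Complex.normSq_apply]
    refine le_trans (le_of_eq ?_) (Real.add_one_le_exp _)
    simp
    ring
  rw [norm_prod]
  refine (Finset.prod_le_prod (fun _ _ => norm_nonneg _) fun k _ => h1 k).trans ?_
  rw [← Real.exp_sum, Real.exp_le_exp, Finset.sum_add_distrib, ← Finset.mul_sum,
    ← Finset.sum_div, ← Finset.mul_sum]
  have h2 : c.re * ∑ k, B k ≤ ‖c‖ * |∑ k, B k| :=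
    (le_abs_self _).trans (by
      rw [abs_mul]
      exact mul_le_mul_of_nonneg_right (Complex.abs_re_le_norm c) (abs_nonneg _))
  have h3 : ∑ k, B k ^ 2 ≤ N * M ^ 2 := by
    refine (Finset.sum_le_sum fun k _ => sq_le_sq' (neg_le_of_abs_le (hM k))
      (le_of_abs_le (hM k))).trans ?_
    simp
  gcongr

/-- Cauchy's estimate for `∏ (1 + z B k)` on the circle of radius `R/√N`, where the product is
bounded uniformly in `N`. The free `R` supplies geometric decay in `r`. -/
lemma abs_elemSymm_le {N : ℕ} (hN : 0 < N) (B : Fin N → ℝ) {M K R : ℝ} (hM : ∀ k, |B k| ≤ M)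
    (hK : |∑ k, B k| ≤ K * √N) (hR : 0 < R) (r : ℕ) :
    |elemSymm B r| ≤ √N ^ r * (Real.exp (R * K + R ^ 2 * M ^ 2 / 2) / R ^ r) := by
  rcases lt_or_ge N r with h | h
  · rw [elemSymm_eq_zero B h, abs_zero]; positivity
  have hs : 0 < √(N : ℝ) := by positivity
  have h1 := norm_coeff_mul_pow_le (N + 1) (fun r => ((elemSymm B r : ℝ) : ℂ)) (R := R / √N)
    (C := Real.exp (R * K + R ^ 2 * M ^ 2 / 2)) (by positivity) (fun z hz => by
      have h2 := prod_add_mul_eq_sum_elemSymm 1 z B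
      simp only [one_pow, one_mul] at h2
      rw [← h2]
      refine (norm_prod_one_add_mul_le z B hM).trans (Real.exp_le_exp.2 ?_)
      rw [hz]
      refine add_le_add ?_ (le_of_eq ?_)
      · refine (mul_le_mul_of_nonneg_left hK (by positivity)).trans (le_of_eq ?_)
        field_simp
      · rw [div_pow, Real.sq_sqrt (Nat.cast_nonneg _)]
        have : (N : ℝ) ≠ 0 := by positivity
        field_simp) (Nat.lt_succ_of_le h)
  rw [Complex.norm_real, Real.norm_eq_abs] at h1
  refine h1.trans (le_of_eq ?_)
  rw [div_pow]
  field_simp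

/-- Averaging `∏ (a + b c(z k) B k)` over an exchangeable weight with asymptotic mean `τ` of `c`
is asymptotically the same as replacing `c (z k)` by `τ`. -/
lemma tendsto_sum_prod_sub {ι : Type*} {l : Filter ι} {N : ι → ℕ} (hN : Tendsto N l atTop)
    {w : (i : ι) → Cube (N i) → ℝ} (hw : ∀ i, IsExchangeableWeight (w i)) (c : Bool → ℝ)
    {T : ι → ℝ} {τ : ℝ} (hT : ∀ i z, w i z ≠ 0 → ∑ k, c (z k) = N i * T i)
    (hτ : Tendsto T l (𝓝 τ)) (B : (i : ι) → Fin (N i) → ℝ) {M K K' : ℝ}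
    (hM : ∀ i k, |B i k| ≤ M) (hK : ∀ᶠ i in l, |∑ k, B i k| ≤ K * √(N i))
    (a b : ι → ℂ) (ha : ∀ i, ‖a i‖ ≤ 1) (hb : ∀ᶠ i in l, ‖b i‖ * √(N i) ≤ K') :
    Tendsto (fun i => ∑ z, (w i z : ℂ) * ∏ k, (a i + b i * (c (z k) * B i k)) -
      ∏ k, (a i + b i * (τ * B i k))) l (𝓝 0) := by
  obtain ⟨Q, hQ1, hQ, hQτ⟩ : ∃ Q : ℝ, 1 ≤ Q ∧ (∀ b, |c b| ≤ Q) ∧ |τ| ≤ Q := by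
    have h1 := abs_nonneg (c true); have h2 := abs_nonneg (c false); have h3 := abs_nonneg τ
    refine ⟨1 + |c true| + |c false| + |τ|, by linarith, ?_, by linarith⟩
    rintro (_ | _) <;> linarith
  set D : ℕ → ι → ℝ := fun r i =>
    mixedMoment (w i) c (Finset.univ.filter fun k => (k : ℕ) < r) with hD
  set term : ι → ℕ → ℂ := fun i r =>
    a i ^ (N i - r) * b i ^ r * elemSymm (B i) r * ((D r i - τ ^ r : ℝ) : ℂ) with hterm
  -- The sums have lengths depending on `i`; as the terms vanish beyond `N i`, they become series
  -- over a common index set, ready for dominated convergence.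
  have heq : ∀ i, ∑ z, (w i z : ℂ) * ∏ k, (a i + b i * (c (z k) * B i k)) -
      ∏ k, (a i + b i * (τ * B i k)) = ∑' r, term i r := by
    intro i
    rw [tsum_eq_sum (s := Finset.range (N i + 1)) (fun r hr => by
      have : N i < r := by simpa using hr
      simp [hterm, elemSymm_eq_zero _ this]), (hw i).sum_prod_eq]
    have h2 := prod_add_mul_eq_sum_elemSymm (a i) (b i * τ) (B i)
    simp only [mul_assoc] at h2
    rw [h2, ← Finset.sum_sub_distrib]
    refine Finset.sum_congr rfl fun r _ => ?_
    simp only [hterm, hD]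
    push_cast
    ring
  simp only [heq]
  -- Chosen so that `(1 + |K'|) Q / R = 1/2`: this ratio combines the bound on `‖b‖√N`, the bound `2
  -- Q^r` on the moment differences and the decay `R^{-r}`.
  set R : ℝ := 2 * (1 + |K'|) * Q with hR
  have hRpos : 0 < R := by positivity
  set C : ℝ := Real.exp (R * K + R ^ 2 * M ^ 2 / 2) with hC
  have hcoef : ∀ᶠ i in l, ∀ r, ‖a i ^ (N i - r) * b i ^ r * elemSymm (B i) r‖ ≤
      C * ((1 + |K'|) / R) ^ r := by
    filter_upwards [hN.eventually_gt_atTop 0, hK, hb] with i hi hKi hbi r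
    rw [norm_mul, norm_mul, norm_pow, norm_pow, Complex.norm_real, Real.norm_eq_abs]
    have h1 : ‖a i‖ ^ (N i - r) ≤ 1 := pow_le_one₀ (norm_nonneg _) (ha i)
    have h2 := abs_elemSymm_le hi (B i) (hM i) hKi hRpos r
    calc ‖a i‖ ^ (N i - r) * ‖b i‖ ^ r * |elemSymm (B i) r|
        ≤ 1 * ‖b i‖ ^ r * (√(N i) ^ r * (C / R ^ r)) := by gcongr
      _ = (‖b i‖ * √(N i)) ^ r * (C / R ^ r) := by rw [mul_pow]; ring
      _ ≤ (1 + |K'|) ^ r * (C / R ^ r) := by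
          gcongr
          have := le_abs_self K'
          linarith
      _ = C * ((1 + |K'|) / R) ^ r := by rw [div_pow]; ring
  have hDτ : ∀ i r, r ≤ N i → |D r i - τ ^ r| ≤ 2 * Q ^ r := by
    intro i r hr
    have h1 := (hw i).abs_mixedMoment_le hQ (Finset.univ.filter fun k => (k : ℕ) < r)
    rw [Fin.card_filter_val_lt, min_eq_right hr] at h1
    have h2 : |τ ^ r| ≤ Q ^ r := by rw [abs_pow]; gcongr
    have := abs_sub (D r i) (τ ^ r)
    linarith
  have hzero : (0 : ℂ) = ∑' _ : ℕ, (0 : ℂ) := by simp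
  rw [hzero]
  refine tendsto_tsum_of_dominated_convergence (bound := fun r => 2 * C * (1 / 2 : ℝ) ^ r)
    (summable_geometric_two.mul_left _) (fun r => ?_) ?_
  · have h1 : Tendsto (fun i => C * ((1 + |K'|) / R) ^ r * |D r i - τ ^ r|) l (𝓝 0) := by
      have h2 := ((tendsto_mixedMoment hN hw c hT hτ r).sub_const (τ ^ r)).abs
      rw [sub_self, abs_zero] at h2
      simpa using h2.const_mul (C * ((1 + |K'|) / R) ^ r)
    refine squeeze_zero_norm' ?_ h1
    filter_upwards [hcoef] with i hi
    rw [hterm, norm_mul, Complex.norm_real, Real.norm_eq_abs]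
    exact mul_le_mul_of_nonneg_right (hi r) (abs_nonneg _)
  · filter_upwards [hcoef] with i hi r
    rcases lt_or_ge (N i) r with h | h
    · rw [hterm]
      simp only [elemSymm_eq_zero _ h, Complex.ofReal_zero, mul_zero, zero_mul, norm_zero]
      positivity
    · rw [hterm, norm_mul, Complex.norm_real, Real.norm_eq_abs]
      calc _ ≤ C * ((1 + |K'|) / R) ^ r * (2 * Q ^ r) :=
            mul_le_mul (hi r) (hDτ i r h) (abs_nonneg _) (by positivity)
        _ = 2 * C * ((1 + |K'|) / R * Q) ^ r := by rw [mul_pow]; ring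
        _ = 2 * C * (1 / 2 : ℝ) ^ r := by
            congr 2
            rw [hR]
            field_simp

/-! ### Sums and products over coordinates in terms of the number of ones. -/

lemma hamming_le {N : ℕ} (x : Cube N) : hamming x ≤ N := by
  simpa [hamming] using Finset.card_le_univ (Finset.univ.filter fun k => x k = true)

lemma card_filter_not {N : ℕ} (x : Cube N) :
    (Finset.univ.filter fun k => ¬ x k = true).card = N - hamming x := by
  have := Finset.card_filter_add_card_filter_not (s := (Finset.univ : Finset (Fin N)))
    (fun k => x k = true)
  simp only [Finset.card_univ, Fintype.card_fin] at this
  unfold hamming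
  omega

lemma prod_apply_cube {N : ℕ} (x : Cube N) (f : Bool → ℂ) :
    ∏ k, f (x k) = f false ^ (N - hamming x) * f true ^ hamming x := by
  have h : ∀ k, f (x k) = if x k = true then f true else f false := by
    intro k; cases x k <;> simp
  simp only [h]
  rw [Finset.prod_ite, Finset.prod_const, Finset.prod_const, card_filter_not, mul_comm]
  rfl

lemma sum_apply_cube {N : ℕ} (x : Cube N) (f : Bool → ℝ) :
    ∑ k, f (x k) = ((N : ℝ) - hamming x) * f false + hamming x * f true := by
  have h : ∀ k, f (x k) = if x k = true then f true else f false := by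
    intro k; cases x k <;> simp
  simp only [h]
  rw [Finset.sum_ite, Finset.sum_const, Finset.sum_const, card_filter_not, add_comm,
    nsmul_eq_mul, nsmul_eq_mul, Nat.cast_sub (hamming_le x)]
  rfl

lemma natCast_mul_density {N : ℕ} (z : Cube N) : (N : ℝ) * density z = hamming z := by
  rcases Nat.eq_zero_or_pos N with rfl | h
  · have := Nat.le_zero.1 (hamming_le z)
    simp [this]
  · unfold density
    have : (N : ℝ) ≠ 0 := by positivity
    field_simp

lemma density_mem_Icc {N : ℕ} (z : Cube N) : density z ∈ Set.Icc (0 : ℝ) 1 :=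
  ⟨by unfold density; positivity, div_le_one_of_le₀ (by exact_mod_cast hamming_le z) (by positivity)⟩

lemma hamming_comp_perm {N : ℕ} (z : Cube N) (σ : Equiv.Perm (Fin N)) :
    hamming (fun k => z (σ k)) = hamming z := by
  unfold hamming
  refine Finset.card_bij (fun k _ => σ k) (by simp) (fun a _ b _ h => σ.injective h) fun b hb => ?_
  exact ⟨σ.symm b, by simpa using hb, by simp⟩

/-! ### One-step characteristic functions and the limiting mean and variance. -/

section Parameters

variable {φ γ : ℝ} (hφ : φ ∈ Set.Ioo (0 : ℝ) 1) (hγ : γ ∈ Set.Ioo (0 : ℝ) 1)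

/-- The factor of the transition probability that depends on the driving coordinate. -/
def driveFactor (φ γ : ℝ) (z : Bool) : ℝ :=
  alpha φ γ / (1 - alpha φ γ) * (1 - bit z / alpha φ γ)

/-- The limit of the mean of `driveFactor` when the density of ones tends to `θ`. -/
def driveMean (φ γ θ : ℝ) : ℝ := alpha φ γ / (1 - alpha φ γ) * (1 - θ / alpha φ γ)

include hφ hγ in
lemma alpha_mem : alpha φ γ ∈ Set.Ioo (0 : ℝ) 1 :=
  ⟨lt_min hφ.1 hγ.1, (min_le_left _ _).trans_lt hφ.2⟩

include hφ in
-- The result is affine in the product of a function of `z` and a function of `x`, which is the form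
-- `a + b c(z) B` needed for the moment expansion. At `h = 0` it shows that the transition weights
-- sum to one.
lemma sum_coordTransition_mul_exp (z x : Bool) (h : ℂ) :
    ∑ y, (coordTransition φ γ z x y : ℂ) * Complex.exp (h * bit y) =
      (1 + φ * (Complex.exp h - 1)) + -((1 - φ) * (Complex.exp h - 1)) *
        (driveFactor φ γ z * (1 - bit x / γ : ℝ)) := by
  have h0 : (φ : ℂ) ≠ 0 := by exact_mod_cast hφ.1.ne'
  rw [Fintype.sum_bool]
  have h1 : coordTransition φ γ z x true =
      φ - (1 - φ) * (driveFactor φ γ z * (1 - bit x / γ)) := by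
    have := hφ.1.ne'
    simp only [coordTransition, driveFactor, if_true]
    generalize alpha φ γ / (1 - alpha φ γ) = q
    simp only [bit, if_true]
    field_simp
    ring
  have h2 : coordTransition φ γ z x false =
      (1 - φ) + (1 - φ) * (driveFactor φ γ z * (1 - bit x / γ)) := by
    simp [coordTransition, driveFactor, bit]
    ring
  rw [h1, h2]
  simp only [bit]
  push_cast
  simp
  ring

include hφ in
lemma sum_coordTransition (z x : Bool) : ∑ y, coordTransition φ γ z x y = 1 := by
  have h := sum_coordTransition_mul_exp (γ := γ) hφ z x 0
  simp only [zero_mul, Complex.exp_zero, mul_one, sub_self, mul_zero, neg_zero, add_zero] at h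
  exact_mod_cast h

include hφ in
lemma sum_prod_coordTransition {N : ℕ} (z x : Cube N) :
    ∑ y : Cube N, ∏ k, coordTransition φ γ (z k) (x k) (y k) = 1 := by
  rw [← Fintype.prod_sum (fun k b => coordTransition φ γ (z k) (x k) b)]
  exact Finset.prod_eq_one fun k _ => sum_coordTransition hφ (z k) (x k)

lemma exp_scaled {N : ℕ} (s : ℝ) (y : Cube N) :
    Complex.exp (s * (scaled φ y : ℝ) * Complex.I) =
      Complex.exp (-(Complex.I * s * φ * √(N : ℝ))) *
        ∏ k, Complex.exp (Complex.I * (s / √N : ℝ) * bit (y k)) := by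
  rw [← Complex.exp_sum, ← Complex.exp_add]
  congr 1
  rw [← Finset.mul_sum, ← Complex.ofReal_sum, sum_apply_cube y bit]
  have h : s * scaled φ y = -(s * φ * √N) + s / √N * (((N : ℝ) - hamming y) * bit false +
      hamming y * bit true) := by
    rw [scaled]
    simp only [bit]
    rcases Nat.eq_zero_or_pos N with rfl | h
    · simp
    · have hs : √(N : ℝ) ≠ 0 := by positivity
      have hs2 : (N : ℝ) = √(N : ℝ) ^ 2 := (Real.sq_sqrt (Nat.cast_nonneg _)).symm
      simp only [Bool.false_eq_true, if_false, if_true]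
      generalize √(N : ℝ) = q at *
      rw [hs2]
      field_simp
      ring
  have hc := congrArg (fun r : ℝ => (r : ℂ)) h
  push_cast at hc ⊢
  linear_combination Complex.I * hc

include hφ in
/-- The characteristic function of the one-step transition of `scaled φ`. -/
lemma sum_prod_coordTransition_mul_exp {N : ℕ} (z x : Cube N) (s : ℝ) :
    ∑ y : Cube N, ((∏ k, coordTransition φ γ (z k) (x k) (y k) : ℝ) : ℂ) *
        Complex.exp (s * (scaled φ y : ℝ) * Complex.I) =
      Complex.exp (-(Complex.I * s * φ * √(N : ℝ))) *
        ∏ k, ((1 + φ * (Complex.exp (Complex.I * (s / √N : ℝ)) - 1)) +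
          -((1 - φ) * (Complex.exp (Complex.I * (s / √N : ℝ)) - 1)) *
          (driveFactor φ γ (z k) * (1 - bit (x k) / γ : ℝ))) := by
  simp only [← sum_coordTransition_mul_exp hφ]
  rw [Fintype.prod_sum, Finset.mul_sum]
  refine Finset.sum_congr rfl fun y _ => ?_
  rw [exp_scaled, Finset.prod_mul_distrib, Complex.ofReal_prod]
  ring

include hφ hγ in
-- Both branches of `psi` equal `(1-φ)α / ((1-α)γ)`.
lemma limitMean_eq (θ u : ℝ) : limitMean φ γ θ u = (1 - φ) * driveMean φ γ θ / γ * u := by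
  have h1 := hφ.1.ne'
  have h2 := hγ.1.ne'
  have h3 : 1 - φ ≠ 0 := by linarith [hφ.2]
  have h4 : 1 - γ ≠ 0 := by linarith [hγ.2]
  unfold limitMean driveMean psi
  by_cases h : φ ≤ γ
  · simp only [alpha, if_pos h, min_eq_left h]
    field_simp
  · simp only [alpha, if_neg h, min_eq_right (not_le.1 h).le]
    field_simp

include hφ hγ in
lemma limitVariance_eq (θ : ℝ) : limitVariance φ γ θ =
    φ * (1 - φ) - (1 - φ) ^ 2 * driveMean φ γ θ ^ 2 * ((1 - γ) / γ) := by
  have h1 := hφ.1.ne'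
  have h2 := hγ.1.ne'
  unfold limitVariance driveMean
  generalize alpha φ γ / (1 - alpha φ γ) = q
  generalize 1 - θ / alpha φ γ = p
  field_simp

include hφ hγ in
-- The claim is `(1-φ)(1-γ)τ² ≤ φγ`. As `τ` is affine in `θ`, running from `α/(1-α)` to `-1`,
-- convexity of the square leaves the endpoints: `θ = 1` is `φ + γ ≥ 1`, and `θ = 0` holds because
-- `α` is the minimum.
lemma limitVariance_nonneg (hφγ : 1 ≤ φ + γ) {θ : ℝ} (hθ : θ ∈ Set.Icc (0 : ℝ) 1) :
    0 ≤ limitVariance φ γ θ := by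
  obtain ⟨hα0, hα1⟩ := alpha_mem hφ hγ
  obtain ⟨hφ0, hφ1⟩ := hφ
  obtain ⟨hγ0, hγ1⟩ := hγ
  obtain ⟨hθ0, hθ1⟩ := hθ
  set q := alpha φ γ / (1 - alpha φ γ) with hq
  have hτ : driveMean φ γ θ = (1 - θ) * q + θ * (-1) := by
    have : 1 - alpha φ γ ≠ 0 := by linarith
    rw [driveMean, hq]
    field_simp
    ring
  have hsq : driveMean φ γ θ ^ 2 ≤ (1 - θ) * q ^ 2 + θ := by
    rw [hτ]
    nlinarith [mul_nonneg (mul_nonneg hθ0 (sub_nonneg.2 hθ1)) (sq_nonneg (q + 1))]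
  have h1 : (1 - φ) * (1 - γ) ≤ φ * γ := by nlinarith
  have h2 : (1 - φ) * (1 - γ) * q ^ 2 ≤ φ * γ := by
    have hd : 0 < (1 - alpha φ γ) ^ 2 := by have : 0 < 1 - alpha φ γ := by linarith
                                            positivity
    rw [hq, div_pow, ← mul_div_assoc, div_le_iff₀ hd]
    rcases le_total φ γ with h | h
    · have : φ * (1 - γ) ≤ γ * (1 - φ) := by nlinarith
      simp only [alpha, min_eq_left h]
      nlinarith [mul_le_mul_of_nonneg_left this (mul_nonneg hφ0.le (sub_nonneg.2 hφ1.le))]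
    · have : γ * (1 - φ) ≤ φ * (1 - γ) := by nlinarith
      simp only [alpha, min_eq_right h]
      nlinarith [mul_le_mul_of_nonneg_left this (mul_nonneg hγ0.le (sub_nonneg.2 hγ1.le))]
  have h3 : (1 - φ) * (1 - γ) * driveMean φ γ θ ^ 2 ≤ φ * γ := by
    have h4 : 0 ≤ (1 - φ) * (1 - γ) := mul_nonneg (by linarith) (by linarith)
    nlinarith [mul_le_mul_of_nonneg_left hsq h4, mul_le_mul_of_nonneg_left h1 hθ0,
      mul_le_mul_of_nonneg_left h2 (sub_nonneg.2 hθ1)]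
  rw [limitVariance_eq ⟨hφ0, hφ1⟩ ⟨hγ0, hγ1⟩]
  have h5 : φ * (1 - φ) - (1 - φ) ^ 2 * driveMean φ γ θ ^ 2 * ((1 - γ) / γ) =
      (1 - φ) / γ * (φ * γ - (1 - φ) * (1 - γ) * driveMean φ γ θ ^ 2) := by
    field_simp
  rw [h5]
  exact mul_nonneg (div_nonneg (by linarith) hγ0.le) (by linarith)

include hφ hγ in
/-- Convergence of the characteristic function, for a fixed starting point and a driving vector
with exchangeable law and fixed density. -/
lemma tendsto_charFun_exchangeable (hφγ : 1 ≤ φ + γ) {ι : Type*} {l : Filter ι} {N : ι → ℕ}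
    (hN : Tendsto N l atTop) {w : (i : ι) → Cube (N i) → ℝ} (hw : ∀ i, IsExchangeableWeight (w i))
    {θs : ι → ℝ} {θ : ℝ} (hθs : ∀ i z, w i z ≠ 0 → density z = θs i) (hθ : Tendsto θs l (𝓝 θ))
    (hθmem : θ ∈ Set.Icc (0 : ℝ) 1)
    (x : (i : ι) → Cube (N i)) {u : ℝ} (hu : Tendsto (fun i => scaled γ (x i)) l (𝓝 u)) (s : ℝ) :
    Tendsto (fun i => ∑ z, (w i z : ℂ) * ∑ y, ((∏ k, coordTransition φ γ (z k) (x i k) (y k) : ℝ) : ℂ) *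
        Complex.exp (s * (scaled φ y : ℝ) * Complex.I)) l
      (𝓝 (charFun (gaussianReal (limitMean φ γ θ u) (limitVariance φ γ θ).toNNReal) s)) := by
  have hα := alpha_mem hφ hγ
  set h : ι → ℝ := fun i => s / √(N i) with hh
  set a : ι → ℂ := fun i => 1 + φ * (Complex.exp (Complex.I * h i) - 1) with ha
  set b : ι → ℂ := fun i => -((1 - φ) * (Complex.exp (Complex.I * h i) - 1)) with hb
  set B : (i : ι) → Fin (N i) → ℝ := fun i k => 1 - bit (x i k) / γ with hB
  set τ := driveMean φ γ θ with hτdef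
  have hT : ∀ i z, w i z ≠ 0 → ∑ k, driveFactor φ γ (z k) = N i * driveMean φ γ (θs i) := by
    intro i z hz
    rw [sum_apply_cube, ← natCast_mul_density z, hθs i z hz]
    simp only [driveFactor, driveMean, bit]
    simp
    ring
  have hτ : Tendsto (fun i => driveMean φ γ (θs i)) l (𝓝 τ) := by
    have : Continuous (driveMean φ γ) := by unfold driveMean; fun_prop
    exact (this.tendsto θ).comp hθ
  have hM : ∀ i k, |B i k| ≤ 1 + 1 / γ := by
    intro i k
    have hg : 0 < 1 / γ := by have := hγ.1; positivity
    simp only [hB, bit]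
    split_ifs
    · rw [abs_le]; constructor <;> linarith
    · rw [zero_div, sub_zero, abs_one]; linarith
  have hN0 : ∀ᶠ i in l, 0 < √(N i : ℝ) := by
    filter_upwards [hN.eventually_gt_atTop 0] with i hi
    positivity
  -- The sum of the `B i k` is `-√N/γ` times the scaled state, which is eventually bounded by `|u| +
  -- 1`; this is where the scaling of the starting point enters.
  have hK : ∀ᶠ i in l, |∑ k, B i k| ≤ ((|u| + 1) / γ) * √(N i) := by
    filter_upwards [hN0, hu.abs.eventually_le_const (lt_add_one |u|)] with i hi hui
    have h1 : ∑ k, B i k = -(√(N i) * scaled γ (x i) / γ) := by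
      rw [hB]
      simp only
      rw [sum_apply_cube (x i) (fun v => 1 - bit v / γ), scaled]
      have := hγ.1.ne'
      simp only [bit]
      simp
      field_simp
      ring
    rw [h1, abs_neg, abs_div, abs_mul, abs_of_pos hi, abs_of_pos hγ.1]
    have := hγ.1
    calc √(N i) * |scaled γ (x i)| / γ ≤ √(N i) * (|u| + 1) / γ := by gcongr
      _ = _ := by ring
  have hha : ∀ i, ‖a i‖ ≤ 1 := by
    intro i
    have : a i = ((1 - φ : ℝ) : ℂ) + (φ : ℝ) * Complex.exp (Complex.I * h i) := by
      simp only [ha]; push_cast; ring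
    rw [this]
    refine (norm_add_le _ _).trans ?_
    rw [norm_mul, mul_comm Complex.I, Complex.norm_exp_ofReal_mul_I, Complex.norm_real,
      Complex.norm_real, Real.norm_eq_abs, Real.norm_eq_abs, abs_of_pos hφ.1,
      abs_of_pos (by linarith [hφ.2])]
    linarith
  have hhb : ∀ᶠ i in l, ‖b i‖ * √(N i) ≤ (1 - φ) * |s| := by
    filter_upwards [hN0] with i hi
    have h1 : ‖b i‖ ≤ (1 - φ) * |h i| := by
      have : b i = -(((1 - φ : ℝ) : ℂ) * (Complex.exp (Complex.I * h i) - 1)) := by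
        simp [hb]
      rw [this, norm_neg, norm_mul, Complex.norm_real, Real.norm_eq_abs,
        abs_of_pos (by linarith [hφ.2])]
      exact mul_le_mul_of_nonneg_left Real.norm_exp_I_mul_ofReal_sub_one_le (by linarith [hφ.2])
    calc ‖b i‖ * √(N i) ≤ (1 - φ) * |h i| * √(N i) := by gcongr
      _ = (1 - φ) * |s| := by
        rw [hh]; simp only [abs_div, abs_of_pos hi]; field_simp
  have hdiff := tendsto_sum_prod_sub hN hw (driveFactor φ γ) hT hτ B hM hK a b hha hhb
  -- The centring factor oscillates with `N` but has modulus one, so it may multiply the vanishing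
  -- difference.
  set E : ι → ℂ := fun i => Complex.exp (-(Complex.I * s * φ * √(N i : ℝ))) with hE
  have hE1 : ∀ i, ‖E i‖ = 1 := by
    intro i
    have : -(Complex.I * s * φ * √(N i : ℝ)) = ((-(s * φ * √(N i)) : ℝ) : ℂ) * Complex.I := by
      push_cast; ring
    rw [hE]; simp only
    rw [this, Complex.norm_exp_ofReal_mul_I]
  have hdiff' : Tendsto (fun i => E i * (∑ z, (w i z : ℂ) *
      ∏ k, (a i + b i * (driveFactor φ γ (z k) * B i k)) -
      ∏ k, (a i + b i * (τ * B i k)))) l (𝓝 0) := by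
    rw [tendsto_zero_iff_norm_tendsto_zero] at hdiff ⊢
    simpa only [norm_mul, hE1, one_mul] using hdiff
  have hmain := tendsto_two_bernoulli_charFun φ γ τ s u hγ.1 hN (fun i => hamming_le (x i)) hu
  have hsum := hdiff'.add hmain
  rw [zero_add] at hsum
  -- Nonnegativity ensures that `toNNReal` does not truncate the variance.
  rw [charFun_gaussianReal, Real.coe_toNNReal _ (limitVariance_nonneg hφ hγ hφγ hθmem),
    limitMean_eq hφ hγ, limitVariance_eq hφ hγ, ← hτdef]
  refine hsum.congr fun i => ?_
  have hprod : ∏ k, (a i + b i * (τ * B i k)) =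
      (1 + (φ - (1 - φ) * τ : ℝ) * (Complex.exp (Complex.I * (s / √(N i) : ℝ)) - 1)) ^
          (N i - hamming (x i)) *
         (1 + (φ + (1 - φ) * τ * ((1 - γ) / γ) : ℝ) *
          (Complex.exp (Complex.I * (s / √(N i) : ℝ)) - 1)) ^ hamming (x i) := by
    rw [hB]
    simp only
    rw [prod_apply_cube (x i) (fun v => a i + b i * (τ * (1 - bit v / γ : ℝ)))]
    have hg : (γ : ℂ) ≠ 0 := by exact_mod_cast hγ.1.ne'
    congr 2
    · simp only [ha, hb, hh, bit]; push_cast; simp; ring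
    · simp only [ha, hb, hh, bit]; push_cast; simp; field_simp; ring
  rw [← hprod]
  simp only [sum_prod_coordTransition_mul_exp hφ]
  rw [mul_sub, sub_add_cancel, Finset.mul_sum]
  refine Finset.sum_congr rfl fun z _ => ?_
  simp only [hE, ha, hb, hB, hh]
  ring

end Parameters

/-! ### Independence and conditional expectations for the walk. -/

lemma integral_comp_eq_sum {Ω ι E : Type*} [MeasurableSpace Ω] {P : Measure Ω} [IsFiniteMeasure P]
    [Fintype ι] [MeasurableSpace ι] [MeasurableSingletonClass ι] [NormedAddCommGroup E]
    [NormedSpace ℝ E] [CompleteSpace E] {G : Ω → ι} (hG : Measurable G) (F : ι → E) :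
    ∫ ω, F (G ω) ∂P = ∑ g, P.real (G ⁻¹' {g}) • F g := by
  have hF : StronglyMeasurable F := StronglyMeasurable.of_discrete
  rw [← integral_map hG.aemeasurable hF.aestronglyMeasurable, integral_fintype .of_finite]
  refine Finset.sum_congr rfl fun g _ => ?_
  rw [map_measureReal_apply hG (measurableSet_singleton g)]

namespace IsExchangeableWalk

variable {φ γ : ℝ} {N : ℕ} {Ω : Type*} [MeasurableSpace Ω] {P : Measure Ω}
  [IsProbabilityMeasure P] {X Z : ℕ → Ω → Cube N}

/-- Markov property: the transition law given only the current state. -/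
lemma measureReal_transition (h : IsExchangeableWalk φ γ P X Z) (t : ℕ) (x z y : Cube N) :
    P.real {ω | X t ω = x ∧ Z (t + 1) ω = z ∧ X (t + 1) ω = y} =
      P.real {ω | X t ω = x} * P.real {ω | Z (t + 1) ω = z} *
        ∏ k, coordTransition φ γ (z k) (x k) (y k) := by
  set H : Ω → (Fin t → Cube N) := fun ω s => X s ω with hH
  have hHm : Measurable H := measurable_pi_lambda _ fun s => h.measurable_X s
  -- A history `g` before time `t`, then `x` at `t` and `y` at `t + 1`; the values after `t + 1` are
  -- filler. Summing over `g` removes the past.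
  set path : (Fin t → Cube N) → ℕ → Cube N := fun g s =>
    if hs : s < t then g ⟨s, hs⟩ else if s = t then x else y with hpath
  have hsplit : ∀ S : Set Ω, MeasurableSet S → P.real S = ∑ g, P.real (H ⁻¹' {g} ∩ S) := by
    intro S hS
    have h1 := sum_measureReal_preimage_singleton (μ := P.restrict S) Finset.univ (f := H)
      (fun g _ => hHm (measurableSet_singleton g))
    simp only [Finset.coe_univ, Set.preimage_univ, measureReal_restrict_apply_univ] at h1
    rw [← h1]
    exact Finset.sum_congr rfl fun g _ =>
      measureReal_restrict_apply (hHm (measurableSet_singleton g))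
  have hpt : ∀ g, path g t = x := fun g => by simp [hpath]
  have hpt1 : ∀ g, path g (t + 1) = y := fun g => by simp [hpath]
  have hpast : ∀ g ω, (H ω = g ∧ X t ω = x) ↔ ∀ s ≤ t, X s ω = path g s := by
    intro g ω
    constructor
    · rintro ⟨rfl, hx⟩ s hs
      rcases hs.lt_or_eq with hlt | rfl
      · simp [hpath, hlt, hH]
      · simp [hpath, hx]
    · intro hs
      refine ⟨funext fun s => ?_, by simpa [hpath] using hs t le_rfl⟩
      simpa [hpath, hH] using hs s s.2.le
  have mX : ∀ s v, MeasurableSet {ω | X s ω = v} := fun s v =>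
    h.measurable_X s (measurableSet_singleton v)
  have mZ : ∀ s v, MeasurableSet {ω | Z s ω = v} := fun s v =>
    h.measurable_Z s (measurableSet_singleton v)
  have mall : MeasurableSet {ω | X t ω = x ∧ Z (t + 1) ω = z ∧ X (t + 1) ω = y} :=
    (mX t x).inter ((mZ (t + 1) z).inter (mX (t + 1) y))
  rw [hsplit _ mall, hsplit _ (mX t x),
    Finset.sum_mul, Finset.sum_mul]
  refine Finset.sum_congr rfl fun g _ => ?_
  have ht := h.transition t (path g) z
  simp only [hpt, hpt1] at ht
  have e1 : H ⁻¹' {g} ∩ {ω | X t ω = x} = {ω | ∀ s ≤ t, X s ω = path g s} := by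
    ext ω; exact hpast g ω
  have e2 : H ⁻¹' {g} ∩ {ω | X t ω = x ∧ Z (t + 1) ω = z ∧ X (t + 1) ω = y} =
      {ω | (∀ s ≤ t, X s ω = path g s) ∧ Z (t + 1) ω = z ∧ X (t + 1) ω = y} := by
    ext ω
    simp only [Set.mem_inter_iff, Set.mem_preimage, Set.mem_singleton_iff, Set.mem_ofPred_eq,
      ← hpast g ω]
    tauto
  rw [e1, e2, ht]

lemma integral_transition {E : Type*} [NormedAddCommGroup E] [NormedSpace ℝ E] [CompleteSpace E]
    (h : IsExchangeableWalk φ γ P X Z) (t : ℕ) (F : Cube N → Cube N → Cube N → E) :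
    ∫ ω, F (X t ω) (Z (t + 1) ω) (X (t + 1) ω) ∂P =
      ∑ x, ∑ z, (P.real {ω | X t ω = x} * P.real {ω | Z (t + 1) ω = z}) •
        ∑ y, (∏ k, coordTransition φ γ (z k) (x k) (y k)) • F x z y := by
  have hG : Measurable fun ω => (X t ω, Z (t + 1) ω, X (t + 1) ω) :=
    (h.measurable_X t).prodMk ((h.measurable_Z (t + 1)).prodMk (h.measurable_X (t + 1)))
  have h1 := integral_comp_eq_sum (P := P) hG fun g : Cube N × Cube N × Cube N => F g.1 g.2.1 g.2.2
  simp only at h1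
  rw [h1, Fintype.sum_prod_type]
  refine Finset.sum_congr rfl fun x _ => ?_
  rw [Fintype.sum_prod_type]
  refine Finset.sum_congr rfl fun z _ => ?_
  rw [Finset.smul_sum]
  refine Finset.sum_congr rfl fun y _ => ?_
  rw [smul_smul, ← h.measureReal_transition t x z y]
  congr 2
  ext ω
  simp [Prod.ext_iff]

/-- Sum the three-variable transition formula over the next state; the transition weights total one.
-/
lemma measureReal_and (h : IsExchangeableWalk φ γ P X Z) (hφ : φ ∈ Set.Ioo (0 : ℝ) 1) (t : ℕ)
    (x z : Cube N) : P.real {ω | X t ω = x ∧ Z (t + 1) ω = z} =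
      P.real {ω | X t ω = x} * P.real {ω | Z (t + 1) ω = z} := by
  have h1 := sum_measureReal_preimage_singleton (μ := P.restrict {ω | X t ω = x ∧ Z (t + 1) ω = z})
    Finset.univ (f := X (t + 1)) (fun g _ => h.measurable_X _ (measurableSet_singleton g))
  simp only [Finset.coe_univ, Set.preimage_univ, measureReal_restrict_apply_univ] at h1
  rw [← h1]
  have h2 : ∀ y, (P.restrict {ω | X t ω = x ∧ Z (t + 1) ω = z}).real (X (t + 1) ⁻¹' {y}) =
      P.real {ω | X t ω = x} * P.real {ω | Z (t + 1) ω = z} *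
        ∏ k, coordTransition φ γ (z k) (x k) (y k) := by
    intro y
    rw [← h.measureReal_transition t x z y,
      measureReal_restrict_apply (h.measurable_X _ (measurableSet_singleton y))]
    congr 1
    ext ω
    simp only [Set.mem_inter_iff, Set.mem_preimage, Set.mem_singleton_iff, Set.mem_ofPred_eq]
    tauto
  simp only [h2]
  rw [← Finset.mul_sum, sum_prod_coordTransition hφ, mul_one]

/-- The driving vector is independent of the current state. -/
lemma indepFun (h : IsExchangeableWalk φ γ P X Z) (hφ : φ ∈ Set.Ioo (0 : ℝ) 1) (t : ℕ) :
    IndepFun (Z (t + 1)) (X t) P := by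
  have hG : Measurable fun ω => (Z (t + 1) ω, X t ω) :=
    (h.measurable_Z (t + 1)).prodMk (h.measurable_X t)
  rw [indepFun_iff_map_prod_eq_prod_map_map (h.measurable_Z _).aemeasurable
    (h.measurable_X _).aemeasurable]
  refine Measure.ext_of_singleton fun p => ?_
  obtain ⟨z, x⟩ := p
  rw [← Set.singleton_prod_singleton, Measure.prod_prod, Measure.map_apply hG (by measurability),
    Measure.map_apply (h.measurable_Z _) (measurableSet_singleton z),
    Measure.map_apply (h.measurable_X _) (measurableSet_singleton x)]
  have h1 := h.measureReal_and hφ t x z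
  have e1 : (fun ω => (Z (t + 1) ω, X t ω)) ⁻¹' ({z} ×ˢ {x}) =
      {ω | X t ω = x ∧ Z (t + 1) ω = z} := by
    ext ω; simp [and_comm]
  rw [e1]
  rw [measureReal_def, measureReal_def, measureReal_def, ← ENNReal.toReal_mul,
    ENNReal.toReal_eq_toReal_iff' (measure_ne_top _ _)
    (ENNReal.mul_ne_top (measure_ne_top _ _) (measure_ne_top _ _))] at h1
  rw [h1, mul_comm]
  rfl

/-- The law of the driving vector conditioned on its density. -/
def condWeight (P : Measure Ω) (V : Ω → Cube N) (θ : ℝ) (z : Cube N) : ℝ :=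
  (P.real {ω | density (V ω) = θ})⁻¹ * if density z = θ then P.real {ω | V ω = z} else 0

lemma sum_ite_measureReal {V : Ω → Cube N} (hV : Measurable V) (p : Cube N → Prop)
    [DecidablePred p] :
    ∑ z, (if p z then P.real {ω | V ω = z} else 0) = P.real {ω | p (V ω)} := by
  rw [← Finset.sum_filter]
  have := sum_measureReal_preimage_singleton (μ := P) (Finset.univ.filter p) (f := V)
    (fun g _ => hV (measurableSet_singleton g))
  refine this.trans ?_
  congr 1
  ext ω
  simp

/-- The density is invariant under permutations, so conditioning on it keeps exchangeability. -/
lemma isExchangeableWeight_condWeight (h : IsExchangeableWalk φ γ P X Z) (t : ℕ) {θ : ℝ}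
    (hθ : P.real {ω | density (Z (t + 1) ω) = θ} ≠ 0) :
    IsExchangeableWeight (condWeight P (Z (t + 1)) θ) where
  nonneg z := by
    unfold condWeight
    split_ifs <;> positivity
  sum_eq_one := by
    simp only [condWeight]
    rw [← Finset.mul_sum, sum_ite_measureReal (h.measurable_Z _) (fun z => density z = θ),
      inv_mul_cancel₀ hθ]
  comp_perm σ z := by
    have h1 : density (fun k => z (σ k)) = density z := by
      unfold density; rw [hamming_comp_perm]
    have h2 := congrArg ENNReal.toReal (h.exchangeable t σ z)
    unfold condWeight
    rw [h1]
    simp only [measureReal_def, h2]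

/-- The conditional expectation of a function of the next state as an average over the current state. -/
lemma integral_scaled_cond (h : IsExchangeableWalk φ γ P X Z) (hφ : φ ∈ Set.Ioo (0 : ℝ) 1) (t : ℕ)
    (θ u : ℝ) (f : ℝ → ℂ) :
    ∫ ω, f (scaled φ (X (t + 1) ω)) ∂(cond P
        {ω | density (Z (t + 1) ω) = θ ∧ scaled γ (X t ω) = u}) =
      ∑ x, (((P.real {ω | scaled γ (X t ω) = u})⁻¹ *
          if scaled γ x = u then P.real {ω | X t ω = x} else 0 : ℝ) : ℂ) *
        ∑ z, (condWeight P (Z (t + 1)) θ z : ℂ) *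
          ∑ y, ((∏ k, coordTransition φ γ (z k) (x k) (y k) : ℝ) : ℂ) * f (scaled φ y) := by
  classical
  set A : Set Ω := {ω | density (Z (t + 1) ω) = θ ∧ scaled γ (X t ω) = u} with hA
  have hd : Measurable (density : Cube N → ℝ) := Measurable.of_discrete
  have hs : Measurable (scaled γ : Cube N → ℝ) := Measurable.of_discrete
  have hAm : MeasurableSet A :=
    ((hd.comp (h.measurable_Z (t + 1))) (measurableSet_singleton θ)).inter
      ((hs.comp (h.measurable_X t)) (measurableSet_singleton u))
  -- By independence the normalising constant splits, giving separate probability weights for `x`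
  -- and for `z`.
  have hPA : P A = P {ω | density (Z (t + 1) ω) = θ} * P {ω | scaled γ (X t ω) = u} :=
    ((h.indepFun hφ t).comp hd hs).measure_inter_preimage_eq_mul {θ} {u}
      (measurableSet_singleton θ) (measurableSet_singleton u)
  have h1 : ∫ ω, f (scaled φ (X (t + 1) ω)) ∂(cond P A) =
      (P.real {ω | density (Z (t + 1) ω) = θ} * P.real {ω | scaled γ (X t ω) = u})⁻¹ •
        ∫ ω, (if density (Z (t + 1) ω) = θ ∧ scaled γ (X t ω) = u then
          f (scaled φ (X (t + 1) ω)) else 0) ∂P := by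
    rw [ProbabilityTheory.cond, integral_smul_measure, ← integral_indicator hAm, hPA,
      ENNReal.toReal_inv, ENNReal.toReal_mul]
    simp only [hA, Set.indicator_apply, Set.mem_ofPred_eq]
    rfl
  rw [h1, h.integral_transition t (fun x z y => if density z = θ ∧ scaled γ x = u then
    f (scaled φ y) else 0), Finset.smul_sum]
  refine Finset.sum_congr rfl fun x _ => ?_
  rw [Finset.smul_sum, Finset.mul_sum]
  refine Finset.sum_congr rfl fun z _ => ?_
  unfold condWeight
  by_cases hz : density z = θ <;> by_cases hx : scaled γ x = u
  · simp only [hz, hx, and_self, if_true, Complex.real_smul]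
    push_cast
    rw [mul_inv]
    ring
  all_goals simp [hz, hx]

end IsExchangeableWalk

/-! ### The conditional central limit theorem. -/

/-- **Conditional central limit theorem** in terms of characteristic functions. -/
theorem tendsto_charFun_cond {φ γ : ℝ} (hφ : φ ∈ Set.Ioo (0 : ℝ) 1) (hγ : γ ∈ Set.Ioo (0 : ℝ) 1)
    (hφγ : 1 ≤ φ + γ) {Ω : ℕ → Type*} [∀ N, MeasurableSpace (Ω N)]
    {P : (N : ℕ) → Measure (Ω N)} [∀ N, IsProbabilityMeasure (P N)]
    {X Z : (N : ℕ) → ℕ → Ω N → Cube N} (hXZ : ∀ N, IsExchangeableWalk φ γ (P N) (X N) (Z N))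
    (t : ℕ) {n : ℕ → ℕ} {θs us : ℕ → ℝ} {θ u : ℝ} (hn : Tendsto n atTop atTop)
    (hθ : Tendsto θs atTop (𝓝 θ)) (hu : Tendsto us atTop (𝓝 u))
    (hpos : ∀ j, P (n j) {ω | density (Z (n j) (t + 1) ω) = θs j ∧
        scaled γ (X (n j) t ω) = us j} ≠ 0) (s : ℝ) :
    Tendsto (fun j => ∫ ω, Complex.exp (s * (scaled φ (X (n j) (t + 1) ω) : ℝ) * Complex.I)
        ∂(cond (P (n j)) {ω | density (Z (n j) (t + 1) ω) = θs j ∧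
          scaled γ (X (n j) t ω) = us j})) atTop
      (𝓝 (charFun (gaussianReal (limitMean φ γ θ u) (limitVariance φ γ θ).toNNReal) s)) := by
  classical
  have hd : ∀ j, (P (n j)).real {ω | density (Z (n j) (t + 1) ω) = θs j} ≠ 0 := fun j h0 =>
    hpos j (measure_mono_null (fun ω hω => hω.1) ((measureReal_eq_zero_iff).1 h0))
  have hs : ∀ j, (P (n j)).real {ω | scaled γ (X (n j) t ω) = us j} ≠ 0 := fun j h0 =>
    hpos j (measure_mono_null (fun ω hω => hω.2) ((measureReal_eq_zero_iff).1 h0))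
  have hne : ∀ j, ∃ ω, density (Z (n j) (t + 1) ω) = θs j ∧ scaled γ (X (n j) t ω) = us j :=
    fun j => nonempty_of_measure_ne_zero (hpos j)
  have hθmem : θ ∈ Set.Icc (0 : ℝ) 1 := by
    refine isClosed_Icc.mem_of_tendsto hθ (Eventually.of_forall fun j => ?_)
    obtain ⟨ω, hω, -⟩ := hne j
    rw [← hω]
    exact density_mem_Icc _
  set L := charFun (gaussianReal (limitMean φ γ θ u) (limitVariance φ γ θ).toNNReal) s with hL
  set I : (j : ℕ) → Cube (n j) → ℂ := fun j x =>
    ∑ z, (IsExchangeableWalk.condWeight (P (n j)) (Z (n j) (t + 1)) (θs j) z : ℂ) *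
      ∑ y, ((∏ k, coordTransition φ γ (z k) (x k) (y k) : ℝ) : ℂ) *
        Complex.exp (s * (scaled φ y : ℝ) * Complex.I) with hI
  -- The fixed-start limit holds for every choice of starting points, in particular for the worst
  -- one compatible with `us j`; the average over `x` is at least as close to `L`.
  have hmax : ∀ j, ∃ x : Cube (n j), scaled γ x = us j ∧
      ∀ x', scaled γ x' = us j → ‖I j x' - L‖ ≤ ‖I j x - L‖ := by
    intro j
    obtain ⟨ω, -, hω⟩ := hne j
    obtain ⟨x, hx, hx'⟩ := Finset.exists_max_image
      (Finset.univ.filter fun x : Cube (n j) => scaled γ x = us j) (fun x => ‖I j x - L‖)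
      ⟨X (n j) t ω, by simpa using hω⟩
    exact ⟨x, by simpa using hx, fun x' h' => hx' x' (by simpa using h')⟩
  choose x hx hxmax using hmax
  have hlim : Tendsto (fun j => I j (x j)) atTop (𝓝 L) :=
    tendsto_charFun_exchangeable hφ hγ hφγ hn
      (fun j => (hXZ (n j)).isExchangeableWeight_condWeight t (hd j))
      (fun j z hz => by
        by_contra hcon
        exact hz (by simp [IsExchangeableWalk.condWeight, hcon])) hθ hθmem x
      (by simpa only [hx] using hu) s
  rw [tendsto_iff_norm_sub_tendsto_zero] at hlim ⊢
  refine squeeze_zero (fun _ => norm_nonneg _) (fun j => ?_) hlim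
  rw [(hXZ (n j)).integral_scaled_cond hφ t (θs j) (us j)
    (fun v => Complex.exp (s * (v : ℝ) * Complex.I))]
  set c : Cube (n j) → ℝ := fun x' => ((P (n j)).real {ω | scaled γ (X (n j) t ω) = us j})⁻¹ *
    if scaled γ x' = us j then (P (n j)).real {ω | X (n j) t ω = x'} else 0 with hc
  have hc0 : ∀ x', 0 ≤ c x' := by
    intro x'; simp only [hc]; split_ifs <;> positivity
  have hc1 : ∑ x', c x' = 1 := by
    simp only [hc]
    rw [← Finset.mul_sum, IsExchangeableWalk.sum_ite_measureReal ((hXZ (n j)).measurable_X t)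
      (fun x' => scaled γ x' = us j), inv_mul_cancel₀ (hs j)]
  have h1 : ∑ x', (c x' : ℂ) * I j x' - L = ∑ x', (c x' : ℂ) * (I j x' - L) := by
    simp only [mul_sub, Finset.sum_sub_distrib, ← Finset.sum_mul]
    rw [← Complex.ofReal_sum, hc1, Complex.ofReal_one, one_mul]
  change ‖∑ x', (c x' : ℂ) * I j x' - L‖ ≤ _
  rw [h1]
  calc ‖∑ x', (c x' : ℂ) * (I j x' - L)‖ ≤ ∑ x', c x' * ‖I j (x j) - L‖ := by
        refine norm_sum_le_of_le _ fun x' _ => ?_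
        rw [norm_mul, Complex.norm_real, Real.norm_eq_abs, abs_of_nonneg (hc0 x')]
        by_cases hx' : scaled γ x' = us j
        · exact mul_le_mul_of_nonneg_left (hxmax j x' hx') (hc0 x')
        · simp [hc, hx']
    _ = ‖I j (x j) - L‖ := by rw [← Finset.sum_mul, hc1, one_mul]

/-- **Conditional central limit theorem**: weak convergence of the conditional laws. -/
theorem tendsto_integral_cond {φ γ : ℝ} (hφ : φ ∈ Set.Ioo (0 : ℝ) 1) (hγ : γ ∈ Set.Ioo (0 : ℝ) 1)
    (hφγ : 1 ≤ φ + γ) {Ω : ℕ → Type*} [∀ N, MeasurableSpace (Ω N)]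
    {P : (N : ℕ) → Measure (Ω N)} [∀ N, IsProbabilityMeasure (P N)]
    {X Z : (N : ℕ) → ℕ → Ω N → Cube N} (hXZ : ∀ N, IsExchangeableWalk φ γ (P N) (X N) (Z N))
    (t : ℕ) {n : ℕ → ℕ} {θs us : ℕ → ℝ} {θ u : ℝ} (hn : Tendsto n atTop atTop)
    (hθ : Tendsto θs atTop (𝓝 θ)) (hu : Tendsto us atTop (𝓝 u))
    (hpos : ∀ j, P (n j) {ω | density (Z (n j) (t + 1) ω) = θs j ∧
        scaled γ (X (n j) t ω) = us j} ≠ 0) (f : BoundedContinuousFunction ℝ ℝ) :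
    Tendsto (fun j => ∫ ω, f (scaled φ (X (n j) (t + 1) ω))
        ∂(cond (P (n j)) {ω | density (Z (n j) (t + 1) ω) = θs j ∧
          scaled γ (X (n j) t ω) = us j})) atTop
      (𝓝 (∫ v, f v ∂(gaussianReal (limitMean φ γ θ u) (limitVariance φ γ θ).toNNReal))) := by
  set Q : (j : ℕ) → Measure (Ω (n j)) := fun j => cond (P (n j))
    {ω | density (Z (n j) (t + 1) ω) = θs j ∧ scaled γ (X (n j) t ω) = us j} with hQ
  have hQp : ∀ j, IsProbabilityMeasure (Q j) := fun j => cond_isProbabilityMeasure (hpos j)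
  have hV : ∀ j, Measurable fun ω => scaled φ (X (n j) (t + 1) ω) := fun j =>
    (Measurable.of_discrete (f := (scaled φ : Cube (n j) → ℝ))).comp ((hXZ (n j)).measurable_X _)
  have hmp : ∀ j, IsProbabilityMeasure ((Q j).map fun ω => scaled φ (X (n j) (t + 1) ω)) :=
    fun j => Measure.isProbabilityMeasure_map (hV j).aemeasurable
  let law : ℕ → ProbabilityMeasure ℝ := fun j =>
    ⟨(Q j).map fun ω => scaled φ (X (n j) (t + 1) ω), hmp j⟩
  let lim : ProbabilityMeasure ℝ :=
    ⟨gaussianReal (limitMean φ γ θ u) (limitVariance φ γ θ).toNNReal, inferInstance⟩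
  have h1 : Tendsto law atTop (𝓝 lim) := by
    refine ProbabilityMeasure.tendsto_iff_tendsto_charFun.2 fun s => ?_
    refine (tendsto_charFun_cond hφ hγ hφγ hXZ t hn hθ hu hpos s).congr fun j => ?_
    simp only [law, ProbabilityMeasure.coe_mk]
    rw [charFun_apply_real, integral_map (hV j).aemeasurable (by fun_prop)]
  refine (ProbabilityMeasure.tendsto_iff_forall_integral_tendsto.1 h1 f).congr fun j => ?_
  simp only [law, ProbabilityMeasure.coe_mk]
  rw [integral_map (hV j).aemeasurable (by fun_prop)]

/-! ### From conditional convergence to joint convergence in distribution. -/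

lemma setIntegral_eq_measureReal_mul_integral_cond {Ω : Type*} [MeasurableSpace Ω] (P : Measure Ω)
    [IsFiniteMeasure P] (A : Set Ω) (f : Ω → ℝ) :
    ∫ ω in A, f ω ∂P = P.real A * ∫ ω, f ω ∂(cond P A) := by
  rw [ProbabilityTheory.cond, integral_smul_measure, smul_eq_mul, ← mul_assoc, ENNReal.toReal_inv,
    measureReal_def]
  rcases eq_or_ne (P A) 0 with h | h
  · simp [h, Measure.restrict_eq_zero.2 h]
  · rw [mul_inv_cancel₀ (ENNReal.toReal_ne_zero.2 ⟨h, measure_ne_top _ _⟩), one_mul]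

/-- Comparison of a joint integral with the integral of a function of the first, finitely valued,
component, when the conditional integrals are close to that function on a set `K`. -/
lemma abs_integral_sub_integral_le {Ω E : Type*} [MeasurableSpace Ω] {P : Measure Ω}
    [IsProbabilityMeasure P] [MeasurableSpace E] [MeasurableSingletonClass E] {p : Ω → E}
    (hp : Measurable p) (hfin : (Set.range p).Finite) {H : Ω → ℝ} (hH : Integrable H P)
    {G : E → ℝ} (hG : Measurable G) {C ε : ℝ} (hε : 0 ≤ ε) (hHC : ∀ ω, |H ω| ≤ C)
    (hGC : ∀ x, |G x| ≤ C) {K : Set E} (hK : MeasurableSet K)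
    (h : ∀ x ∈ K, P {ω | p ω = x} ≠ 0 → |∫ ω, H ω ∂(cond P {ω | p ω = x}) - G x| ≤ ε) :
    |∫ ω, H ω ∂P - ∫ ω, G (p ω) ∂P| ≤ ε + 2 * C * P.real {ω | p ω ∉ K} := by
  classical
  have hGint : Integrable (fun ω => G (p ω)) P :=
    Integrable.of_bound (hG.comp hp).aestronglyMeasurable C (Eventually.of_forall fun ω => hGC _)
  set D : Ω → ℝ := fun ω => H ω - G (p ω) with hD
  have hDint : Integrable D P := hH.sub hGint
  have hmx : ∀ x, MeasurableSet {ω | p ω = x} := fun x => hp (measurableSet_singleton x)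
  have hcover : (⋃ x ∈ hfin.toFinset, {ω | p ω = x}) = Set.univ := by
    ext ω; simp
  have hsum : ∀ D : Ω → ℝ, Integrable D P → ∫ ω, D ω ∂P =
      ∑ x ∈ hfin.toFinset, ∫ ω in {ω | p ω = x}, D ω ∂P := by
    intro D hD
    rw [← integral_biUnion_finset _ (fun x _ => hmx x) (fun x _ y _ hxy => by
      rw [Function.onFun, Set.disjoint_left]
      rintro ω rfl h2
      exact hxy h2) (fun x _ => hD.integrableOn), hcover, setIntegral_univ]
  -- On each atom the error is `ε` if its value lies in `K` and the trivial `2C` otherwise; null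
  -- atoms contribute nothing.
  have hterm : ∀ x, |∫ ω in {ω | p ω = x}, D ω ∂P| ≤
      ∫ ω in {ω | p ω = x}, (ε + (if p ω ∉ K then 2 * C else 0)) ∂P := by
    intro x
    have hr : ∫ ω in {ω | p ω = x}, (ε + (if p ω ∉ K then 2 * C else 0)) ∂P =
        P.real {ω | p ω = x} * (ε + (if x ∉ K then 2 * C else 0)) := by
      rw [setIntegral_congr_fun (g := fun _ => ε + (if x ∉ K then 2 * C else 0)) (hmx x)
        (fun ω hω => by
          have : p ω = x := hω
          simp only [this]), setIntegral_const, smul_eq_mul]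
    have hl : ∫ ω in {ω | p ω = x}, D ω ∂P =
        P.real {ω | p ω = x} * ∫ ω, (H ω - G x) ∂(cond P {ω | p ω = x}) := by
      rw [← setIntegral_eq_measureReal_mul_integral_cond]
      refine setIntegral_congr_fun (hmx x) fun ω hω => ?_
      have : p ω = x := hω
      simp only [hD, this]
    rw [hr, hl, abs_mul, abs_of_nonneg measureReal_nonneg]
    rcases eq_or_ne (P {ω | p ω = x}) 0 with h0 | h0
    · simp [measureReal_def, h0]
    refine mul_le_mul_of_nonneg_left ?_ measureReal_nonneg
    have hpr : IsProbabilityMeasure (cond P {ω | p ω = x}) := cond_isProbabilityMeasure h0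
    have hHm : AEStronglyMeasurable H (cond P {ω | p ω = x}) :=
      hH.aestronglyMeasurable.mono_ac (cond_absolutelyContinuous)
    have hHi : Integrable H (cond P {ω | p ω = x}) :=
      Integrable.of_bound hHm C (Eventually.of_forall hHC)
    by_cases hxK : x ∈ K
    · simp only [hxK, not_true_eq_false, if_false, add_zero]
      rw [integral_sub hHi (integrable_const _), integral_const, probReal_univ, one_smul]
      exact h x hxK h0
    · simp only [hxK, not_false_eq_true, if_true]
      have hb : ∀ ω, ‖H ω - G x‖ ≤ 2 * C := fun ω => by
        have h1 := norm_sub_le (H ω) (G x)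
        have h2 := hHC ω
        have h3 := hGC x
        simp only [Real.norm_eq_abs] at h1 ⊢
        linarith
      have := norm_integral_le_of_norm_le_const (μ := cond P {ω | p ω = x}) (Eventually.of_forall hb)
      rw [probReal_univ, mul_one, Real.norm_eq_abs] at this
      linarith
  have hKc : MeasurableSet {ω | p ω ∉ K} := hp hK.compl
  have hind : (fun ω => if p ω ∉ K then 2 * C else 0) =
      Set.indicator {ω | p ω ∉ K} fun _ => 2 * C := by
    ext ω; simp [Set.indicator_apply]
  have hbint : Integrable (fun ω => if p ω ∉ K then 2 * C else 0) P := by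
    rw [hind]; exact (integrable_const _).indicator hKc
  rw [← integral_sub hH hGint, hsum D hDint]
  refine (Finset.abs_sum_le_sum_abs _ _).trans ((Finset.sum_le_sum fun x _ => hterm x).trans ?_)
  rw [← hsum (fun ω => ε + if p ω ∉ K then 2 * C else 0) ((integrable_const ε).add hbint),
    integral_add (integrable_const ε) hbint, hind,
    integral_indicator hKc, setIntegral_const, integral_const, probReal_univ, one_smul, smul_eq_mul,
    mul_comm (P.real _)]

/-- Integrals of a bounded Lipschitz function along a slice are Lipschitz in the slice. -/
lemma abs_integral_slice_sub_le {Ω E : Type*} [MeasurableSpace Ω] [PseudoMetricSpace E]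
    (μ : Measure Ω) [IsProbabilityMeasure μ] {F : E × ℝ → ℝ} {L : NNReal} (hL : LipschitzWith L F)
    {C : ℝ} (hC : ∀ y, |F y| ≤ C) {W : Ω → ℝ} (hW : Measurable W) (x y : E) :
    |∫ ω, F (x, W ω) ∂μ - ∫ ω, F (y, W ω) ∂μ| ≤ L * dist x y := by
  have hFc : Continuous F := hL.continuous
  have hi : ∀ x, Integrable (fun ω => F (x, W ω)) μ := fun x =>
    Integrable.of_bound ((by fun_prop : Continuous fun v => F (x, v)).measurable.comp
      hW).aestronglyMeasurable C (Eventually.of_forall fun ω => hC _)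
  rw [← integral_sub (hi x) (hi y)]
  have hb : ∀ ω, ‖F (x, W ω) - F (y, W ω)‖ ≤ L * dist x y := by
    intro ω
    have := hL.dist_le_mul (x, W ω) (y, W ω)
    rw [dist_eq_norm, Prod.dist_eq, dist_self, max_eq_left dist_nonneg] at this
    exact this
  have := norm_integral_le_of_norm_le_const (μ := μ) (Eventually.of_forall hb)
  simpa using this

/-- If finitely valued random elements `p N` converge in distribution to `ν`, and the conditional
laws of `V N` given `p N` converge continuously to a Feller kernel `κ`, then `(p N, V N)` converges in
distribution to `ν ⊗ₘ κ`. -/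
theorem tendstoInDistribution_compProd {E : Type*} [MetricSpace E] [MeasurableSpace E]
    [BorelSpace E] [SecondCountableTopology E] [CompleteSpace E]
    {Ω : ℕ → Type*} [∀ N, MeasurableSpace (Ω N)] {P : (N : ℕ) → Measure (Ω N)}
    [∀ N, IsProbabilityMeasure (P N)] {p : (N : ℕ) → Ω N → E} {V : (N : ℕ) → Ω N → ℝ}
    (hp : ∀ N, Measurable (p N)) (hfin : ∀ N, (Set.range (p N)).Finite) (hV : ∀ N, Measurable (V N))
    (ν : Measure E) [IsProbabilityMeasure ν] (κ : Kernel E ℝ) [IsMarkovKernel κ]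
    (hpν : TendstoInDistribution p atTop (id : E → E) P ν)
    (hκ : ∀ f : BoundedContinuousFunction ℝ ℝ, Continuous fun x => ∫ v, f v ∂(κ x))
    (hcond : ∀ (n : ℕ → ℕ) (x : ℕ → E) (x₀ : E), Tendsto n atTop atTop → Tendsto x atTop (𝓝 x₀) →
      (∀ j, P (n j) {ω | p (n j) ω = x j} ≠ 0) → ∀ f : BoundedContinuousFunction ℝ ℝ,
      Tendsto (fun j => ∫ ω, f (V (n j) ω) ∂(cond (P (n j)) {ω | p (n j) ω = x j})) atTop
        (𝓝 (∫ v, f v ∂(κ x₀)))) :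
    TendstoInDistribution (fun N ω => (p N ω, V N ω)) atTop (id : E × ℝ → E × ℝ) P (ν ⊗ₘ κ) := by
  have hpV : ∀ N, Measurable fun ω => (p N ω, V N ω) := fun N => (hp N).prodMk (hV N)
  refine ⟨fun N => (hpV N).aemeasurable, aemeasurable_id, ?_⟩
  -- With Lipschitz test functions, moving the first coordinate changes a slice uniformly in the
  -- second, so conditioning values can be frozen at their limit.
  refine tendsto_iff_forall_lipschitz_integral_tendsto.2 ?_
  rintro F ⟨C₀, hC₀⟩ ⟨L, hL⟩
  simp only [ProbabilityMeasure.coe_mk, Measure.map_id]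
  have hFc : Continuous F := hL.continuous
  obtain ⟨C, hC0, hC⟩ : ∃ C : ℝ, 0 < C ∧ ∀ y, |F y| ≤ C := by
    have hne : Nonempty E := nonempty_of_isProbabilityMeasure ν
    obtain ⟨x⟩ := hne
    refine ⟨|F (x, 0)| + |C₀| + 1, by positivity, fun y => ?_⟩
    have h1 := hC₀ y (x, 0)
    rw [Real.dist_eq] at h1
    have h2 := abs_sub_abs_le_abs_sub (F y) (F (x, 0))
    have h3 := le_abs_self C₀
    linarith
  have hFint : ∀ (x : E) (μ : Measure ℝ) [IsProbabilityMeasure μ], Integrable (fun v => F (x, v)) μ :=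
    fun x μ _ => Integrable.of_bound (by fun_prop) C (Eventually.of_forall fun v => hC _)
  set slice : E → BoundedContinuousFunction ℝ ℝ := fun x =>
    BoundedContinuousFunction.ofNormedAddCommGroup (fun v => F (x, v)) (by fun_prop) C
      (fun v => hC _) with hslice
  set G : E → ℝ := fun x => ∫ v, F (x, v) ∂(κ x) with hG
  have hGC : ∀ x, |G x| ≤ C := fun x => by
    have := norm_integral_le_of_norm_le_const (μ := κ x) (f := fun v => F (x, v))
      (Eventually.of_forall fun v => hC (x, v))
    simpa using this
  have hGcont : Continuous G := by
    rw [continuous_iff_continuousAt]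
    intro x₀
    have h1 : Tendsto (fun x => ∫ v, F (x₀, v) ∂(κ x)) (𝓝 x₀) (𝓝 (G x₀)) :=
      (hκ (slice x₀)).tendsto x₀
    have h2 : Tendsto (fun x => G x - ∫ v, F (x₀, v) ∂(κ x)) (𝓝 x₀) (𝓝 0) := by
      refine squeeze_zero_norm (fun x => abs_integral_slice_sub_le (κ x) hL hC measurable_id x x₀) ?_
      have : Continuous fun x => (L : ℝ) * dist x x₀ := by fun_prop
      simpa using this.tendsto x₀
    have h3 := h2.add h1
    rw [zero_add] at h3
    exact h3.congr fun x => sub_add_cancel _ _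
  -- uniform convergence of the conditional integrals on compact sets
  have hunif : ∀ K : Set E, IsCompact K → ∀ ε > 0, ∀ᶠ N in atTop, ∀ x ∈ K,
      P N {ω | p N ω = x} ≠ 0 →
        |∫ ω, F (p N ω, V N ω) ∂(cond (P N) {ω | p N ω = x}) - G x| ≤ ε := by
    intro K hK ε hε
    by_contra hcon
    rw [not_eventually] at hcon
    -- If uniformity fails, compactness gives bad conditioning values converging to some `x₀`;
    -- `hcond` and continuity of `G` contradict this along the subsequence.
    obtain ⟨n, hn, hbad⟩ := extraction_of_frequently_atTop hcon
    push Not at hbad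
    choose x hxK hpos hgt using hbad
    obtain ⟨x₀, -, ψ, hψ, hlim⟩ := hK.tendsto_subseq hxK
    have hn' : Tendsto (n ∘ ψ) atTop atTop := hn.tendsto_atTop.comp hψ.tendsto_atTop
    have hpr : ∀ j, IsProbabilityMeasure
        (cond (P (n (ψ j))) {ω | p (n (ψ j)) ω = x (ψ j)}) := fun j =>
      cond_isProbabilityMeasure (hpos _)
    have h1 := hcond (n ∘ ψ) (x ∘ ψ) x₀ hn' hlim (fun j => hpos (ψ j)) (slice x₀)
    have h2 : Tendsto (fun j =>
        ∫ ω, F (x (ψ j), V (n (ψ j)) ω) ∂(cond (P (n (ψ j))) {ω | p (n (ψ j)) ω = x (ψ j)}) -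
        ∫ ω, F (x₀, V (n (ψ j)) ω) ∂(cond (P (n (ψ j))) {ω | p (n (ψ j)) ω = x (ψ j)})) atTop
        (𝓝 0) := by
      refine squeeze_zero_norm (fun j => abs_integral_slice_sub_le _ hL hC (hV _) _ _) ?_
      have : Continuous fun x => (L : ℝ) * dist x x₀ := by fun_prop
      simpa [Function.comp_def] using (this.tendsto x₀).comp hlim
    have h3 := h2.add h1
    have h4 : Tendsto (fun j => G (x (ψ j))) atTop (𝓝 (G x₀)) := (hGcont.tendsto x₀).comp hlim
    have h5 := (h3.sub h4).abs
    have h6 : (0 : ℝ) + ∫ v, slice x₀ v ∂(κ x₀) - G x₀ = 0 := by simp [hslice, hG]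
    rw [h6, abs_zero] at h5
    obtain ⟨j, hj⟩ := (h5.eventually_lt_const hε).exists
    refine absurd (hgt (ψ j)) (not_lt.2 (le_trans (le_of_eq ?_) hj.le))
    congr 2
    have hcg : ∫ ω, F (p (n (ψ j)) ω, V (n (ψ j)) ω)
          ∂(cond (P (n (ψ j))) {ω | p (n (ψ j)) ω = x (ψ j)}) =
        ∫ ω, F (x (ψ j), V (n (ψ j)) ω)
          ∂(cond (P (n (ψ j))) {ω | p (n (ψ j)) ω = x (ψ j)}) := by
      refine integral_congr_ae ?_
      filter_upwards [ae_cond_mem (hp _ (measurableSet_singleton (x (ψ j))))] with ω hω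
      have : p (n (ψ j)) ω = x (ψ j) := hω
      rw [this]
    rw [hcg]
    simp [hslice]
  have hGlim : Tendsto (fun N => ∫ ω, G (p N ω) ∂(P N)) atTop (𝓝 (∫ x, G x ∂ν)) := by
    have h2 := ProbabilityMeasure.tendsto_iff_forall_integral_tendsto.1 hpν.tendsto (BoundedContinuousFunction.ofNormedAddCommGroup G hGcont C hGC)
    simp only [ProbabilityMeasure.coe_mk, Measure.map_id,
      BoundedContinuousFunction.coe_ofNormedAddCommGroup] at h2
    refine h2.congr fun N => ?_
    rw [integral_map (hp N).aemeasurable hGcont.aestronglyMeasurable]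
  -- A convergent sequence of laws together with its limit is compact, hence tight in a complete
  -- separable space.
  have htight : ∀ ε > 0, ∃ K : Set E, IsCompact K ∧ ∀ N, (P N).real {ω | p N ω ∉ K} ≤ ε := by
    intro ε hε
    have h1 := isTightMeasureSet_of_isCompact_closure
      (hpν.tendsto.isCompact_insert_range.closure)
    rw [isTightMeasureSet_iff_exists_isCompact_measure_compl_le] at h1
    obtain ⟨K, hK, hKε⟩ := h1 (ENNReal.ofReal ε) (by simpa using hε)
    refine ⟨K, hK, fun N => ?_⟩
    have h2 := hKε ((P N).map (p N)) ⟨_, Set.mem_insert_of_mem _ ⟨N, rfl⟩, rfl⟩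
    rw [Measure.map_apply (hp N) hK.measurableSet.compl] at h2
    exact ENNReal.toReal_le_of_le_ofReal hε.le h2
  have hFpV : ∀ N, Integrable (fun ω => F (p N ω, V N ω)) (P N) := fun N =>
    Integrable.of_bound (hFc.measurable.comp (hpV N)).aestronglyMeasurable C
      (Eventually.of_forall fun ω => hC _)
  have hdiff : Tendsto (fun N => ∫ ω, F (p N ω, V N ω) ∂(P N) - ∫ ω, G (p N ω) ∂(P N)) atTop
      (𝓝 0) := by
    rw [Metric.tendsto_atTop']
    intro ε hε
    obtain ⟨K, hK, hKε⟩ := htight (ε / (8 * C)) (by positivity)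
    obtain ⟨N₀, hN₀⟩ := eventually_atTop.1 (hunif (closure K) hK.closure (ε / 2) (by positivity))
    refine ⟨N₀, fun N hN => ?_⟩
    rw [Real.dist_eq, sub_zero]
    have h1 := abs_integral_sub_integral_le (hp N) (hfin N) (hFpV N) hGcont.measurable
      (by positivity : 0 ≤ ε / 2) (fun ω => hC _) hGC isClosed_closure.measurableSet (hN₀ N hN.le)
    have h2 : (P N).real {ω | p N ω ∉ closure K} ≤ ε / (8 * C) :=
      (measureReal_mono (fun ω (hω : p N ω ∉ closure K) hK' => hω (subset_closure hK'))).trans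
        (hKε N)
    have h3 : 2 * C * (P N).real {ω | p N ω ∉ closure K} ≤ ε / 4 := by
      refine (mul_le_mul_of_nonneg_left h2 (by positivity)).trans (le_of_eq ?_)
      field_simp
      norm_num
    linarith
  have hfinal := hdiff.add hGlim
  rw [zero_add] at hfinal
  have hlimit : ∫ y, F y ∂(ν ⊗ₘ κ) = ∫ x, G x ∂ν :=
    Measure.integral_compProd (Integrable.of_bound hFc.aestronglyMeasurable C
      (Eventually.of_forall hC))
  rw [hlimit]
  refine hfinal.congr fun N => ?_
  rw [sub_add_cancel, integral_map (hpV N).aemeasurable hFc.aestronglyMeasurable]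

/-! ### Joint limit for the walk. -/

/-- The limiting normal law depends continuously on its parameters. -/
lemma continuous_integral_limitKernel (φ γ : ℝ) (f : BoundedContinuousFunction ℝ ℝ) :
    Continuous fun p => ∫ v, f v ∂(limitKernel φ γ p) := by
  rw [continuous_iff_seqContinuous]
  intro p p₀ hp
  let law : ℝ × ℝ → ProbabilityMeasure ℝ := fun q => ⟨limitKernel φ γ q, inferInstance⟩
  have h1 : Tendsto (fun j => law (p j)) atTop (𝓝 (law p₀)) := by
    refine ProbabilityMeasure.tendsto_iff_tendsto_charFun.2 fun s => ?_
    have hc : Continuous fun p : ℝ × ℝ => charFun (limitKernel φ γ p) s := by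
      have : ∀ p : ℝ × ℝ, charFun (limitKernel φ γ p) s = Complex.exp
          (s * limitMean φ γ p.1 p.2 * Complex.I - (limitVariance φ γ p.1).toNNReal * s ^ 2 / 2) :=
        fun p => charFun_gaussianReal s
      simp only [this]
      unfold limitMean limitVariance
      have h : Continuous fun x : ℝ => ((x.toNNReal : ℝ) : ℂ) := by fun_prop
      fun_prop
    exact (hc.tendsto p₀).comp hp
  exact ProbabilityMeasure.tendsto_iff_forall_integral_tendsto.1 h1 f

/-- Joint convergence in distribution of the density, the current state and the next state. -/
theorem tendstoInDistribution_density_scaled_scaled {φ γ : ℝ} (hφ : φ ∈ Set.Ioo (0 : ℝ) 1)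
    (hγ : γ ∈ Set.Ioo (0 : ℝ) 1) (hφγ : 1 ≤ φ + γ) {Ω : ℕ → Type*} [∀ N, MeasurableSpace (Ω N)]
    {P : (N : ℕ) → Measure (Ω N)} [∀ N, IsProbabilityMeasure (P N)]
    {X Z : (N : ℕ) → ℕ → Ω N → Cube N} (hXZ : ∀ N, IsExchangeableWalk φ γ (P N) (X N) (Z N))
    (t : ℕ) (lawΘ lawU : ProbabilityMeasure ℝ)
    (hΘ : TendstoInDistribution (fun N ω => density (Z N (t + 1) ω)) atTop
      (id : ℝ → ℝ) P (lawΘ : Measure ℝ))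
    (hU : TendstoInDistribution (fun N ω => scaled γ (X N t ω)) atTop
      (id : ℝ → ℝ) P (lawU : Measure ℝ)) :
    TendstoInDistribution
        (fun N ω => ((density (Z N (t + 1) ω), scaled γ (X N t ω)), scaled φ (X N (t + 1) ω)))
        atTop (id : (ℝ × ℝ) × ℝ → (ℝ × ℝ) × ℝ) P
        (((lawΘ : Measure ℝ).prod (lawU : Measure ℝ)) ⊗ₘ limitKernel φ γ) := by
  have hd : ∀ N, Measurable fun ω => density (Z N (t + 1) ω) := fun N =>
    (Measurable.of_discrete (f := (density : Cube N → ℝ))).comp ((hXZ N).measurable_Z _)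
  have hs : ∀ N (q : ℝ) t, Measurable fun ω => scaled q (X N t ω) := fun N q t =>
    (Measurable.of_discrete (f := (scaled q : Cube N → ℝ))).comp ((hXZ N).measurable_X _)
  refine tendstoInDistribution_compProd (fun N => (hd N).prodMk (hs N γ t)) (fun N => ?_)
    (fun N => hs N φ (t + 1)) _ (limitKernel φ γ) ?_ (continuous_integral_limitKernel φ γ) ?_
  · refine (Set.finite_range fun q : Cube N × Cube N => (density q.1, scaled γ q.2)).subset ?_
    rintro _ ⟨ω, rfl⟩
    exact ⟨(Z N (t + 1) ω, X N t ω), rfl⟩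
  · refine ⟨fun N => ((hd N).prodMk (hs N γ t)).aemeasurable, aemeasurable_id, ?_⟩
    -- The joint law of density and scaled state is a product for each `N`, so marginal convergence
    -- suffices and the limit is again a product.
    have h1 := (ProbabilityMeasure.continuous_prod.tendsto _).comp
      (hΘ.tendsto.prodMk_nhds hU.tendsto)
    refine (h1.congr fun N => Subtype.ext ?_).mono_right
      (le_of_eq (congrArg 𝓝 (Subtype.ext (by simp; rfl))))
    exact ((indepFun_iff_map_prod_eq_prod_map_map (hd N).aemeasurable (hs N γ t).aemeasurable).1
      (((hXZ N).indepFun hφ t).comp (Measurable.of_discrete (f := (density : Cube N → ℝ)))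
        (Measurable.of_discrete (f := (scaled γ : Cube N → ℝ))))).symm
  · intro n x x₀ hn hx hpos f
    simp only [Prod.ext_iff] at hpos ⊢
    exact tendsto_integral_cond hφ hγ hφγ hXZ t hn ((continuous_fst.tendsto _).comp hx)
      ((continuous_snd.tendsto _).comp hx) hpos f

end HypercubeWalk

end

theorem mainTheorem8
    (φ γ : ℝ) (hφ : φ ∈ Set.Ioo (0 : ℝ) 1) (hγ : γ ∈ Set.Ioo (0 : ℝ) 1) (hφγ : 1 ≤ φ + γ)
    -- for every `N`, a walk on `{0,1}^N`
    {Ω : ℕ → Type*} [∀ N, MeasurableSpace (Ω N)]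
    (P : (N : ℕ) → Measure (Ω N)) [∀ N, IsProbabilityMeasure (P N)]
    (X Z : (N : ℕ) → ℕ → Ω N → HypercubeWalk.Cube N)
    (hXZ : ∀ N, HypercubeWalk.IsExchangeableWalk φ γ (P N) (X N) (Z N))
    -- a time `t + 1 ≥ 1`, and the law of the limit `Θ ∈ [0,1]` of `‖Z_{t+1}‖ / N`
    (t : ℕ)
    (lawΘ : ProbabilityMeasure ℝ) (hΘ_mem : ∀ᵐ θ ∂(lawΘ : Measure ℝ), θ ∈ Set.Icc (0 : ℝ) 1)
    (hΘ : TendstoInDistribution (fun N ω => HypercubeWalk.density (Z N (t + 1) ω)) atTop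
      (id : ℝ → ℝ) P (lawΘ : Measure ℝ)) :
    -- the expression for the variance is never negative
    (∀ θ ∈ Set.Icc (0 : ℝ) 1, 0 ≤ HypercubeWalk.limitVariance φ γ θ) ∧
    -- conditional central limit theorem: given `‖Z_{t+1}‖ / N = θ_N → θ` and `U^(N) = u_N → u`
    -- (along any sequence of dimensions in which the conditioning makes sense)
    (∀ (n : ℕ → ℕ) (θs us : ℕ → ℝ) (θ u : ℝ), Tendsto n atTop atTop →
      Tendsto θs atTop (𝓝 θ) → Tendsto us atTop (𝓝 u) →
      (∀ j, P (n j) {ω | HypercubeWalk.density (Z (n j) (t + 1) ω) = θs j ∧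
        HypercubeWalk.scaled γ (X (n j) t ω) = us j} ≠ 0) →
      ∀ f : BoundedContinuousFunction ℝ ℝ,
        Tendsto (fun j => ∫ ω, f (HypercubeWalk.scaled φ (X (n j) (t + 1) ω))
            ∂(ProbabilityTheory.cond (P (n j))
              {ω | HypercubeWalk.density (Z (n j) (t + 1) ω) = θs j ∧
                HypercubeWalk.scaled γ (X (n j) t ω) = us j}))
          atTop
          (𝓝 (∫ v, f v ∂(gaussianReal (HypercubeWalk.limitMean φ γ θ u)
            (HypercubeWalk.limitVariance φ γ θ).toNNReal)))) ∧
    -- whenever `U^(N)` has a limit `U` in distribution, `(‖Z_{t+1}‖ / N, U^(N), V^(N))` converges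
    -- in distribution to a triple `(Θ, U, V)` with `Θ`, `U` independent, in which `V` given
    -- `Θ = θ`, `U = u` is normal with the stated mean and variance
    (∀ lawU : ProbabilityMeasure ℝ,
      TendstoInDistribution (fun N ω => HypercubeWalk.scaled γ (X N t ω)) atTop
        (id : ℝ → ℝ) P (lawU : Measure ℝ) →
      TendstoInDistribution
        (fun N ω => ((HypercubeWalk.density (Z N (t + 1) ω), HypercubeWalk.scaled γ (X N t ω)),
          HypercubeWalk.scaled φ (X N (t + 1) ω)))
        atTop (id : (ℝ × ℝ) × ℝ → (ℝ × ℝ) × ℝ) P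
        (((lawΘ : Measure ℝ).prod (lawU : Measure ℝ)) ⊗ₘ HypercubeWalk.limitKernel φ γ)) := by
  refine ⟨fun θ hθ => HypercubeWalk.limitVariance_nonneg hφ hγ hφγ hθ, ?_, fun lawU hU => ?_⟩
  · intro n θs us θ u hn hθ hu hpos f
    exact HypercubeWalk.tendsto_integral_cond hφ hγ hφγ hXZ t hn hθ hu hpos f
  · exact HypercubeWalk.tendstoInDistribution_density_scaled_scaled hφ hγ hφγ hXZ t lawΘ lawU
      hΘ hU
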